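/- For a countable graph $\Gamma$, give $\operatorname{Aut}(\Gamma)$ the topology with basis the sets of all automorphisms extending a given finite partial automorphism (a restriction of an automorphism to a finite set of vertices). For $f\in\operatorname{Aut}(\Gamma)$ let $D_f$ be the set of all $g\in\operatorname{Aut}(\Gamma)$ such that the subgroup $\langle f,g\rangle$ is dense in $\operatorname{Aut}(\Gamma)$. A set of orbit representatives of $g$ is a set of vertices containing exactly one vertex of every orbit of $g$ (that is, of $\langle g\rangle$). Let $\mathcal I(\Gamma)$ be the set of automorphisms of $\Gamma$ with no finite orbits, and, for a set $\Sigma$ of vertices, let $\mathcal I_\Sigma(\Gamma)$ be the set of those $g\in\mathcal I(\Gamma)$ that have $\Sigma$ as a set of orbit representatives. For $f\in\operatorname{Aut}(\Gamma)$ let $\overline f$ be the permutation of the set of connected components of $\Gamma$ induced by $f$. The support of $f$ (or of $\overline f$) is the set of points it moves. A subset of a space is comeagre if it contains a countable intersection of dense open sets of that space; sets of automorphisms carry the subspace topology. (i) Let $n\ge 3$ and let $H(n)$ be the universal $K_n$-free graph, i.e. the countably infinite $K_n$-free graph such that for all disjoint finite sets $U,V$ of vertices with $U$ being $K_{n-1}$-free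 there is a vertex $w\notin U\cup V$ adjacent to every vertex in $U$ and to no vertex in $V$. If $f\in\operatorname{Aut}(H(n))$ has infinite support, then $D_f\cap\mathcal I(H(n))$ is comeagre in $\mathcal I(H(n))$. (ii) Let $n\ge 1$ and let $\omega K_n$ be the disjoint union of countably infinitely many copies of the complete graph $K_n$. If $f\in\operatorname{Aut}(\omega K_n)$ is such that $\overline f$ has infinite support, and $\Sigma$ is a finite set of vertices of $\omega K_n$, then $D_f\cap\mathcal I_\Sigma(\omega K_n)$ is comeagre in $\mathcal I_\Sigma(\omega K_n)$. (iii) Let $n\ge 2$ and let $nK_\omega$ be the disjoint union of $n$ copies of the countably infinite complete graph $K_\omega$. For $f\in\operatorname{Aut}(nK_\omega)$ and a set $\Sigma$ of vertices let $\mathcal A_f$ be the set of all $g\in\operatorname{Aut}(nK_\omega)$ such that $\overline f$ and $\overline g$ generate the full symmetric group on the set of the $n$ components, and let $\mathcal A_{f,\Sigma}$ be the set of those $g\in\mathcal A_f$ that have $\Sigma$ as a set of orbit representatives. Suppose that for every nonempty finite set $\Gamma$ of vertices that is setwise stabilised by $f$ there are components $L,L'$ with $|L\cap\Gamma|\ne|L'\cap\Gamma|$.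 Then $D_f\cap\mathcal A_{f,\Sigma}$ is comeagre in $\mathcal A_{f,\Sigma}$ for every finite set $\Sigma$ of vertices. -/

import Mathlib

open Set

section AutomorphismGroups

variable {V : Type*} {G : SimpleGraph V}

/-- The set of automorphisms of `G` that agree with `f` on the finite set `s`, that is, the set of
all automorphisms extending the finite partial automorphism `f|_s`. -/
def autBasic (f : G ≃g G) (s : Finset V) : Set (G ≃g G) :=
  {g | ∀ x ∈ s, g x = f x}

/-- The natural topology on `Aut(G)`, generated by the sets of all extensions of a finite partial
automorphism. -/
instance autTopology (G : SimpleGraph V) : TopologicalSpace (G ≃g G) :=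
  TopologicalSpace.generateFrom {U | ∃ (f : G ≃g G) (s : Finset V), U = autBasic f s}

/-- `Y` is comeagre in the subspace `X` (with the subspace topology). -/
def ComeagreIn {T : Type*} [TopologicalSpace T] (Y X : Set T) : Prop :=
  ((↑) ⁻¹' Y : Set X) ∈ residual X

/-- The support of an automorphism. -/
def autSupport (f : G ≃g G) : Set V := {x | f x ≠ x}

/-- The orbit of `x` under the cyclic group generated by `g`. -/
def autOrbit (g : G ≃g G) (x : V) : Set V := Set.range fun k : ℤ => (g ^ k) x

/-- `S` contains exactly one vertex of every orbit of `g`. -/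
def IsOrbitReps (S : Set V) (g : G ≃g G) : Prop :=
  ∀ x : V, ∃! y : V, y ∈ S ∧ y ∈ autOrbit g x

/-- `D_f`: the automorphisms which together with `f` generate a dense subgroup of `Aut(G)`. -/
def denseMates (f : G ≃g G) : Set (G ≃g G) :=
  {g | Dense ((Subgroup.closure {f, g} : Subgroup (G ≃g G)) : Set (G ≃g G))}

/-- `𝓘(G)`: the automorphisms of `G` with no finite orbits. -/
def noFiniteOrbits (G : SimpleGraph V) : Set (G ≃g G) :=
  {g | ∀ x : V, (autOrbit g x).Infinite}

/-- `𝓘_S(G)`: the automorphisms with no finite orbits having `S` as a set of orbit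
representatives. -/
def noFiniteOrbitsReps (G : SimpleGraph V) (S : Set V) : Set (G ≃g G) :=
  {g | g ∈ noFiniteOrbits G ∧ IsOrbitReps S g}

/-- The permutation of the connected components of `G` induced by an automorphism. -/
def componentPerm (f : G ≃g G) : Equiv.Perm G.ConnectedComponent :=
  f.connectedComponentEquiv

/-- `𝓐_f`: the automorphisms `g` such that the permutations of the components induced by `f` and
`g` generate the full symmetric group on the set of components. -/
def componentMates (f : G ≃g G) : Set (G ≃g G) :=
  {g | Subgroup.closure {componentPerm f, componentPerm g} =
    (⊤ : Subgroup (Equiv.Perm G.ConnectedComponent))}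

/-- `𝓐_{f,S}`: the elements of `𝓐_f` having `S` as a set of orbit representatives. -/
def componentMatesReps (f : G ≃g G) (S : Set V) : Set (G ≃g G) :=
  {g | g ∈ componentMates f ∧ IsOrbitReps S g}

end AutomorphismGroups

/-- `G` is (a copy of) the universal `K_n`-free graph `H(n)`: a countably infinite `K_n`-free graph
with the Alice's restaurant property for `K_n`-free graphs. -/
structure IsUniversalCliqueFree {V : Type*} (n : ℕ) (G : SimpleGraph V) : Prop where
  countable : Countable V
  infinite : Infinite V
  cliqueFree : G.CliqueFree n
  restaurant : ∀ A B : Finset V, Disjoint A B → G.CliqueFreeOn (A : Set V) (n - 1) →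
    ∃ w : V, w ∉ A ∧ w ∉ B ∧ (∀ a ∈ A, G.Adj w a) ∧ ∀ b ∈ B, ¬ G.Adj w b

/-- The disjoint union, indexed by `ι`, of copies of the complete graph on `κ`. -/
def disjointCliques (ι κ : Type*) : SimpleGraph (ι × κ) where
  Adj x y := x.1 = y.1 ∧ x.2 ≠ y.2
  symm := ⟨fun _ _ h => ⟨h.1.symm, h.2.symm⟩⟩
  loopless := ⟨fun _ h => h.2 rfl⟩

/-- `ωK_n`: countably infinitely many copies of the complete graph on `n` vertices. -/
abbrev omegaK (n : ℕ) : SimpleGraph (ℕ × Fin n) := disjointCliques ℕ (Fin n)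

/-- `nK_ω`: `n` copies of the countably infinite complete graph. -/
abbrev copiesKomega (n : ℕ) : SimpleGraph (Fin n × ℕ) := disjointCliques (Fin n) ℕ

/-! ### Topology of the automorphism group and the Baire category reduction -/

section Topology

variable {V : Type*} {G : SimpleGraph V}

/-! All three parts are category arguments. A word in `f` and `g` uses only finitely many values of
`g`, so hitting a given finite partial map is an open condition on `g`. There are countably many
such maps. It therefore suffices to modify `g` inside the given class, away from a finite set, so
that some word hits the map (`comeagreIn_denseMates`).

For ωK_n and nK_ω the modification is conjugation of `g` by an automorphism `a` fixing a large
finite set. This keeps orbit representatives and prescribed values, and for large `N` the map `a` is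
still free on the points that `g ^ N` pushes far out. The freedom is used to plant a copy of the
target `h` inside `f`. In ωK_n, where `f` moves infinitely many cliques, the word (g')^N f (g')^N
can imitate any `h` (`omegaK_dense_step`).

In nK_ω the word is a conjugate of `f`, so it reaches only those `h` that permute components as `f`
does and behave compatibly with the components almost fixed by `f` (`cluster_dense_step`). The
hypothesis on finite invariant sets makes all orbits of the generated group infinite, so Neumann's
lemma lets points escape the finite orbits of `g`. It also provides a component that is not almost
fixed. Quotients of the reachable targets give all transpositions within that component, conjugation
carries these to every component, and the full symmetric group on components supplies the rest
(`cluster_approximable`).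

For H(n), finite partial isomorphisms without cycles are extended instead. Cycle-freeness is
witnessed by a rank increasing by one along the map. New images are chosen with only the forced
adjacencies, and adjacency to the old points is then pulled back one step at each application of
`g`. Since the rank is bounded on old points, it dies out after boundedly many steps. Hence a tuple
and its image under `h` can be moved to unconstrained tuples, forwards and backwards respectively
(`IsRankedPartialIso.exists_neutral`), and one further application of `g` matches them
(`universalCliqueFree_dense_step`). -/

theorem isOpen_autBasic (f : G ≃g G) (s : Finset V) : IsOpen (autBasic f s) :=
  TopologicalSpace.isOpen_generateFrom_of_mem ⟨f, s, rfl⟩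

theorem autBasic_subset_of_isOpen {U : Set (G ≃g G)} (hU : IsOpen U) :
    ∀ g ∈ U, ∃ s : Finset V, autBasic g s ⊆ U := by
  classical
  induction hU with
  | basic U hU =>
    obtain ⟨f, s, rfl⟩ := hU
    exact fun g hg => ⟨s, fun k hk x hx => (hk x hx).trans (hg x hx)⟩
  | univ => exact fun g _ => ⟨∅, fun _ _ => trivial⟩
  | inter U W _ _ ihU ihW =>
    intro g hg
    obtain ⟨s, hs⟩ := ihU g hg.1
    obtain ⟨t, ht⟩ := ihW g hg.2
    exact ⟨s ∪ t, fun k hk => ⟨hs fun x hx => hk x (Finset.mem_union_left _ hx),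
      ht fun x hx => hk x (Finset.mem_union_right _ hx)⟩⟩
  | sUnion S _ ih =>
    rintro g ⟨U, hU, hg⟩
    obtain ⟨s, hs⟩ := ih U hU g hg
    exact ⟨s, hs.trans (subset_sUnion_of_mem hU)⟩

/-- On a finite set, a fixed word in `f` and `g` depends only on finitely many values of `g`. -/
theorem exists_finset_of_mem_closure (f g : G ≃g G) {w : G ≃g G}
    (hw : w ∈ Subgroup.closure {f, g}) (X : Finset V) :
    ∃ A : Finset V, ∀ g' : G ≃g G, (∀ x ∈ A, g' x = g x) →
      ∃ w' ∈ Subgroup.closure {f, g'}, ∀ x ∈ X, w' x = w x := by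
  classical
  induction hw using Subgroup.closure_induction generalizing X with
  | mem w hw =>
    rcases hw with rfl | rfl
    · exact ⟨∅, fun g' _ => ⟨w, Subgroup.subset_closure (by simp), fun _ _ => rfl⟩⟩
    · exact ⟨X, fun g' h => ⟨g', Subgroup.subset_closure (by simp), h⟩⟩
  | one => exact ⟨∅, fun g' _ => ⟨1, one_mem _, fun _ _ => rfl⟩⟩
  | mul a b _ _ iha ihb =>
    obtain ⟨A, hA⟩ := iha (X.image b)
    obtain ⟨B, hB⟩ := ihb X
    refine ⟨A ∪ B, fun g' h => ?_⟩
    obtain ⟨a', ha', ha⟩ := hA g' fun x hx => h x (Finset.mem_union_left _ hx)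
    obtain ⟨b', hb', hb⟩ := hB g' fun x hx => h x (Finset.mem_union_right _ hx)
    refine ⟨a' * b', mul_mem ha' hb', fun x hx => ?_⟩
    rw [RelIso.mul_apply, RelIso.mul_apply, hb x hx, ha _ (Finset.mem_image_of_mem _ hx)]
  | inv a _ iha =>
    -- Agreement with `a` on a⁻¹(X) is what makes the inverses agree on `X`.
    obtain ⟨A, hA⟩ := iha (X.image (a⁻¹ : G ≃g G))
    refine ⟨A, fun g' h => ?_⟩
    obtain ⟨a', ha', ha⟩ := hA g' h
    refine ⟨a'⁻¹, inv_mem ha', fun x hx => ?_⟩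
    have := ha _ (Finset.mem_image_of_mem _ hx)
    rw [RelIso.apply_inv_self] at this
    rw [← this, RelIso.inv_apply_self, this]

/-- The group generated by `f` and `g` contains an extension of the finite relation `q`. -/
def Realises (f g : G ≃g G) (q : Finset (V × V)) : Prop :=
  ∃ w ∈ Subgroup.closure {f, g}, ∀ ab ∈ q, w ab.1 = ab.2

theorem mem_denseMates_iff {f g : G ≃g G} : g ∈ denseMates f ↔
    ∀ (h : G ≃g G) (t : Finset V), ∃ w ∈ Subgroup.closure {f, g}, ∀ x ∈ t, w x = h x := by
  constructor
  · intro hg h t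
    obtain ⟨w, hw, hw'⟩ := Dense.inter_open_nonempty hg _ (isOpen_autBasic h t)
      ⟨h, fun _ _ => rfl⟩
    exact ⟨w, hw', hw⟩
  · intro H
    refine dense_iff_inter_open.2 fun U hU ⟨h, hh⟩ => ?_
    obtain ⟨s, hs⟩ := autBasic_subset_of_isOpen hU h hh
    obtain ⟨w, hw, hw'⟩ := H h s
    exact ⟨w, hs hw', hw⟩

/-- Each `q` in `Q` defines a dense open subset of `X`, and `Q` is countable. `Q` need not contain
every finite partial automorphism: it is enough that realising `Q` forces density. -/
theorem comeagreIn_denseMates [Countable V] (f : G ≃g G) (X : Set (G ≃g G))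
    (Q : Set (Finset (V × V)))
    (hdense : ∀ q ∈ Q, ∀ g ∈ X, ∀ s : Finset V,
      ∃ g' ∈ X, (∀ x ∈ s, g' x = g x) ∧ Realises f g' q)
    (hmates : ∀ g ∈ X, (∀ q ∈ Q, Realises f g q) → g ∈ denseMates f) :
    ComeagreIn (denseMates f ∩ X) X := by
  classical
  have key : ∀ q ∈ Q, {g : X | Realises f (g : G ≃g G) q} ∈ residual X := by
    intro q hq
    refine residual_of_dense_open ?_ ?_
    · have : IsOpen {g : G ≃g G | Realises f g q} := by
        refine isOpen_iff_forall_mem_open.2 ?_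
        rintro g ⟨w, hw, hwq⟩
        obtain ⟨A, hA⟩ := exists_finset_of_mem_closure f g hw (q.image Prod.fst)
        refine ⟨autBasic g A, fun g' hg' => ?_, isOpen_autBasic _ _, fun _ _ => rfl⟩
        obtain ⟨w', hw', h⟩ := hA g' hg'
        exact ⟨w', hw', fun ab hab => (h _ (Finset.mem_image_of_mem _ hab)).trans (hwq ab hab)⟩
      exact this.preimage continuous_subtype_val
    · refine dense_iff_inter_open.2 ?_
      rintro _ ⟨U, hU, rfl⟩ ⟨g, hg⟩
      obtain ⟨s, hs⟩ := autBasic_subset_of_isOpen hU g hg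
      obtain ⟨g', hg', hgs, h⟩ := hdense q hq g g.2 s
      exact ⟨⟨g', hg'⟩, hs hgs, h⟩
  have := (countable_bInter_mem Q.to_countable).2 key
  refine Filter.mem_of_superset this fun g hg => ⟨hmates g g.2 fun q hq => ?_, g.2⟩
  exact mem_iInter₂.1 hg q hq

theorem comeagreIn_denseMates_of_forall [Countable V] (f : G ≃g G) (X : Set (G ≃g G))
    (hdense : ∀ (h : G ≃g G) (t : Finset V), ∀ g ∈ X, ∀ s : Finset V,
      ∃ g' ∈ X, (∀ x ∈ s, g' x = g x) ∧ ∃ w ∈ Subgroup.closure {f, g'}, ∀ x ∈ t, w x = h x) :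
    ComeagreIn (denseMates f ∩ X) X := by
  classical
  refine comeagreIn_denseMates f X
    {q | ∃ (h : G ≃g G) (t : Finset V), q = t.image fun x => (x, h x)} ?_ ?_
  · rintro _ ⟨h, t, rfl⟩ g hg s
    obtain ⟨g', hg', hs, w, hw, hwt⟩ := hdense h t g hg s
    exact ⟨g', hg', hs, w, hw, by simpa using hwt⟩
  · intro g _ H
    refine mem_denseMates_iff.2 fun h t => ?_
    obtain ⟨w, hw, hwt⟩ := H _ ⟨h, t, rfl⟩
    exact ⟨w, hw, by simpa using hwt⟩

end Topology

/-! ### Conjugation, and escape along infinite orbits -/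

section Conjugation

variable {V : Type*} {G : SimpleGraph V}

theorem conj_apply_eq {a g : G ≃g G} {x : V} (hx : a x = x) (hgx : a (g x) = g x) :
    (a⁻¹ * g * a) x = g x := by
  rw [RelIso.mul_apply, RelIso.mul_apply, hx]
  conv_lhs => rw [← hgx, RelIso.inv_apply_self]

theorem autOrbit_conj (a g : G ≃g G) (x : V) :
    autOrbit (a⁻¹ * g * a) x = (a⁻¹ : G ≃g G) '' autOrbit g (a x) := by
  have h : ∀ k : ℤ, (a⁻¹ * g * a) ^ k = a⁻¹ * g ^ k * a := fun k => by
    simpa using conj_zpow (a := a⁻¹) (b := g) (i := k)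
  simp only [autOrbit, h, RelIso.mul_apply, ← range_comp]
  rfl

theorem noFiniteOrbits_conj {a g : G ≃g G} (hg : g ∈ noFiniteOrbits G) :
    a⁻¹ * g * a ∈ noFiniteOrbits G := fun x => by
  rw [autOrbit_conj]
  exact (hg (a x)).image (a⁻¹ : G ≃g G).injective.injOn

/-- The orbits of the conjugate are the a⁻¹-images of those of `g`, and `a` fixes `S` pointwise, so
they meet `S` in the same points. -/
theorem isOrbitReps_conj {a g : G ≃g G} {S : Set V} (hg : IsOrbitReps S g)
    (ha : ∀ x ∈ S, a x = x) : IsOrbitReps S (a⁻¹ * g * a) := by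
  intro x
  have h : ∀ y ∈ S, (y ∈ autOrbit (a⁻¹ * g * a) x ↔ y ∈ autOrbit g (a x)) := by
    intro y hy
    rw [autOrbit_conj]
    constructor
    · rintro ⟨z, hz, rfl⟩
      have := ha _ hy
      rw [RelIso.apply_inv_self] at this
      rwa [← this]
    · intro h
      exact ⟨y, h, by conv_lhs => rw [← ha y hy, RelIso.inv_apply_self]⟩
  obtain ⟨y, ⟨hy, hyo⟩, hu⟩ := hg (a x)
  exact ⟨y, ⟨hy, (h y hy).2 hyo⟩, fun z hz => hu z ⟨hz.1, (h z hz.1).1 hz.2⟩⟩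

theorem zpow_apply_injective {g : G ≃g G} {x : V} (hx : (autOrbit g x).Infinite) :
    Function.Injective fun k : ℤ => (g ^ k) x := by
  intro i j hij
  by_contra hne
  wlog h : j < i generalizing i j
  · exact this hij.symm (Ne.symm hne) (by omega)
  refine hx ?_
  obtain ⟨d, hd, rfl⟩ : ∃ d : ℤ, 0 < d ∧ i = j + d := ⟨i - j, by omega, by omega⟩
  have hfix : (g ^ d) x = x := by
    have h1 : (g ^ j) ((g ^ d) x) = (g ^ j) x := by
      rw [← RelIso.mul_apply, ← zpow_add]; exact hij
    exact (g ^ j).injective h1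
  have hmul : ∀ m : ℤ, (g ^ (d * m)) x = x := by
    intro m
    rw [zpow_mul]
    generalize g ^ d = u at hfix
    induction m using Int.induction_on with
    | zero => rfl
    | succ m ih => rw [zpow_add_one, RelIso.mul_apply, hfix, ih]
    | pred m ih =>
      rw [zpow_sub_one, RelIso.mul_apply]
      conv_lhs => rw [← hfix, RelIso.inv_apply_self, ih]
  refine ((Set.finite_Ico 0 d).image fun k => (g ^ k) x).subset ?_
  rintro _ ⟨k, rfl⟩
  refine ⟨k % d, ⟨Int.emod_nonneg _ hd.ne', Int.emod_lt_of_pos _ hd⟩, ?_⟩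
  conv_rhs => rw [← Int.emod_add_mul_ediv k d]
  simp only [zpow_add, RelIso.mul_apply, hmul]

/-- On an infinite orbit the powers of `g` act injectively in the exponent, so each point visits `Y`
only finitely often. -/
theorem eventually_zpow_ne {g : G ≃g G} {X : Finset V} (hX : ∀ x ∈ X, (autOrbit g x).Infinite)
    (Y : Finset V) : ∃ K : ℕ, ∀ k : ℤ, K ≤ |k| → ∀ x ∈ X, (g ^ k) x ∉ Y := by
  have hfin : {k : ℤ | ∃ x ∈ X, (g ^ k) x ∈ Y}.Finite := by
    have : {k : ℤ | ∃ x ∈ X, (g ^ k) x ∈ Y} =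
        ⋃ x ∈ X, (fun k : ℤ => (g ^ k) x) ⁻¹' (Y : Set V) := by ext; simp
    rw [this]
    exact X.finite_toSet.biUnion fun x hx =>
      Y.finite_toSet.preimage (zpow_apply_injective (hX x hx)).injOn
  obtain ⟨K, hK⟩ := (hfin.image fun k => k.natAbs).bddAbove
  refine ⟨K + 1, fun k hk x hx hy => ?_⟩
  have : k.natAbs ≤ K := hK ⟨k, ⟨x, hx, hy⟩, rfl⟩
  rw [Int.abs_eq_natAbs] at hk
  omega

end Conjugation

/-! ### Extending finite partial injections and choosing fresh points -/

section FinitePartialMaps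

/-- A finite partial injection preserving `c` extends to a product of transpositions
preserving `c`. -/
theorem exists_perm_extending {α γ : Type*} [DecidableEq α] (c : α → γ) (P : Equiv.Perm α → Prop)
    (one : P 1) (step : ∀ e x y, c x = c y → P e → P (Equiv.swap x y * e))
    (pres : ∀ e, P e → ∀ x, c (e x) = c x) (q : Finset (α × α))
    (hc : ∀ p ∈ q, c p.1 = c p.2) (hinj : ∀ p ∈ q, ∀ r ∈ q, p.1 = r.1 ↔ p.2 = r.2) :
    ∃ e, P e ∧ ∀ p ∈ q, e p.1 = p.2 := by
  induction q using Finset.induction_on with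
  | empty => exact ⟨1, one, by simp⟩
  | insert p q hp ih =>
    obtain ⟨e, he, heq⟩ := ih (fun r hr => hc r (Finset.mem_insert_of_mem hr))
      fun r hr s hs => hinj r (Finset.mem_insert_of_mem hr) s (Finset.mem_insert_of_mem hs)
    -- By injectivity no earlier target equals `e p.1` or `p.2`, so the swap preserves the values
    -- already arranged.
    refine ⟨Equiv.swap (e p.1) p.2 * e, step _ _ _ ?_ he, fun r hr => ?_⟩
    · rw [pres e he, hc p (Finset.mem_insert_self _ _)]
    · rcases Finset.mem_insert.1 hr with rfl | hr'
      · simp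
      · have h := hinj p (Finset.mem_insert_self _ _) r hr
        have hne : p.1 ≠ r.1 := fun h1 => hp (by
          have : p = r := Prod.ext h1 (h.1 h1)
          rwa [this])
        rw [Equiv.Perm.mul_apply, heq r hr', Equiv.swap_apply_of_ne_of_ne]
        · rw [← heq r hr']
          exact fun h1 => hne (e.injective h1.symm)
        · exact fun h1 => hne (h.2 h1.symm)

/-- Finitely many points can be chosen in prescribed infinite sets, so that they and their images
under `f` avoid a finite set and each other. -/
theorem exists_fresh {α β : Type*} [Nonempty β] (f : Equiv.Perm β) (P : α → Set β) (A : Finset β)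
    (T : Finset α) (hP : ∀ i ∈ T, (P i).Infinite) :
    ∃ z : α → β, (∀ i ∈ T, z i ∈ P i ∧ z i ∉ A ∧ f (z i) ∉ A) ∧
      ∀ i ∈ T, ∀ j ∈ T, i ≠ j → z i ≠ z j ∧ z i ≠ f (z j) := by
  classical
  induction T using Finset.induction_on with
  | empty => exact ⟨fun _ => Classical.arbitrary β, by simp, by simp⟩
  | insert i T hi ih =>
    obtain ⟨z, hz, hzz⟩ := ih fun j hj => hP j (Finset.mem_insert_of_mem hj)
    set U : Finset β := A ∪ T.image z
    obtain ⟨b, hb, hbU⟩ := (hP i (Finset.mem_insert_self _ _)).exists_notMem_finset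
      (U ∪ U.image f ∪ U.image f.symm)
    simp only [Finset.mem_union, Finset.mem_image, not_or, not_exists, not_and, U] at hbU
    obtain ⟨⟨⟨hbA, hbz⟩, hbf⟩, hbs⟩ := hbU
    have hfA : f b ∉ A := fun h => hbs _ (Or.inl h) (by simp)
    have hfz : ∀ j ∈ T, f b ≠ z j := fun j hj h =>
      hbs (f b) (Or.inr ⟨j, hj, h.symm⟩) (by simp)
    have hzf : ∀ j ∈ T, b ≠ f (z j) := fun j hj h => hbf (z j) (Or.inr ⟨j, hj, rfl⟩) h.symm
    have hne : ∀ j ∈ T, j ≠ i := fun j hj h => hi (h ▸ hj)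
    refine ⟨Function.update z i b, fun j hj => ?_, fun j hj k hk hjk => ?_⟩
    · rcases Finset.mem_insert.1 hj with rfl | hj
      · simpa using ⟨hb, hbA, hfA⟩
      · simpa [hne j hj] using hz j hj
    · rcases Finset.mem_insert.1 hj with rfl | hj' <;> rcases Finset.mem_insert.1 hk with rfl | hk'
      · exact absurd rfl hjk
      · simpa [hne k hk'] using ⟨fun h => hbz k hk' h.symm, hzf k hk'⟩
      · simpa [hne j hj'] using ⟨hbz j hj', fun h => hfz j hj' h.symm⟩
      · simpa [hne j hj', hne k hk'] using hzz j hj' k hk' hjk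

end FinitePartialMaps

/-! ### Disjoint unions of cliques, and the case of ωK_n -/

section DisjointCliques

variable {ι κ : Type*}

theorem fst_apply_eq_iff (f : disjointCliques ι κ ≃g disjointCliques ι κ) (x y : ι × κ) :
    (f x).1 = (f y).1 ↔ x.1 = y.1 := by
  have h := f.map_rel_iff (a := x) (b := y)
  have h' : ∀ u v : ι × κ, u ≠ v → ((disjointCliques ι κ).Adj u v ↔ u.1 = v.1) := by
    intro u v huv
    exact ⟨fun h => h.1, fun h => ⟨h, fun h2 => huv (Prod.ext h h2)⟩⟩
  by_cases hxy : x = y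
  · simp [hxy]
  · rwa [h' x y hxy, h' _ _ (f.injective.ne hxy)] at h

theorem disjointCliques_mk_eq_iff (x y : ι × κ) :
    (disjointCliques ι κ).connectedComponentMk x = (disjointCliques ι κ).connectedComponentMk y ↔
      x.1 = y.1 := by
  rw [SimpleGraph.ConnectedComponent.eq]
  constructor
  · rintro ⟨p⟩
    induction p with
    | nil => rfl
    | cons h _ ih => exact h.1.trans ih
  · intro h
    by_cases h2 : x.2 = y.2
    · rw [Prod.ext h h2]
    · exact SimpleGraph.Adj.reachable ⟨h, h2⟩

theorem disjointCliques_adj_iff (x y : ι × κ) : (disjointCliques ι κ).Adj x y ↔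
    x ≠ y ∧ (disjointCliques ι κ).connectedComponentMk x =
      (disjointCliques ι κ).connectedComponentMk y := by
  rw [disjointCliques_mk_eq_iff]
  exact ⟨fun h => ⟨fun e => h.2 (e ▸ rfl), h.1⟩, fun h => ⟨h.2, fun e => h.1 (Prod.ext h.2 e)⟩⟩

/-- A permutation preserving the partition into cliques, as an automorphism. -/
def cliquesIso (e : Equiv.Perm (ι × κ)) (h : ∀ x y, (e x).1 = (e y).1 ↔ x.1 = y.1) :
    disjointCliques ι κ ≃g disjointCliques ι κ where
  toEquiv := e
  map_rel_iff' {x y} := by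
    rw [disjointCliques_adj_iff, disjointCliques_adj_iff, disjointCliques_mk_eq_iff,
      disjointCliques_mk_eq_iff, h, e.injective.ne_iff]

variable [Nonempty κ]

/-- The permutation of the index set of the cliques induced by an automorphism. -/
noncomputable def indexPerm (f : disjointCliques ι κ ≃g disjointCliques ι κ) : Equiv.Perm ι where
  toFun i := (f (i, Classical.arbitrary κ)).1
  invFun i := (f.symm (i, Classical.arbitrary κ)).1
  left_inv i := by
    have := (fst_apply_eq_iff f.symm ((f (i, Classical.arbitrary κ)).1, Classical.arbitrary κ)
      (f (i, Classical.arbitrary κ))).2 rfl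
    simp only [this, RelIso.symm_apply_apply]
  right_inv i := by
    have := (fst_apply_eq_iff f ((f.symm (i, Classical.arbitrary κ)).1, Classical.arbitrary κ)
      (f.symm (i, Classical.arbitrary κ))).2 rfl
    simp only [this, RelIso.apply_symm_apply]

theorem indexPerm_fst (f : disjointCliques ι κ ≃g disjointCliques ι κ) (x : ι × κ) :
    indexPerm f x.1 = (f x).1 :=
  (fst_apply_eq_iff f (x.1, Classical.arbitrary κ) x).2 rfl

theorem infinite_indexPerm_support (f : disjointCliques ι κ ≃g disjointCliques ι κ)
    (hf : {c | componentPerm f c ≠ c}.Infinite) : {i | indexPerm f i ≠ i}.Infinite := by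
  refine Set.Infinite.of_image
    (fun i => (disjointCliques ι κ).connectedComponentMk (i, Classical.arbitrary κ)) (hf.mono ?_)
  intro c hc
  induction c using SimpleGraph.ConnectedComponent.ind with | _ x
  refine ⟨x.1, fun h => hc ?_, (disjointCliques_mk_eq_iff _ _).2 rfl⟩
  refine (disjointCliques_mk_eq_iff (f x) x).2 ?_
  rw [← indexPerm_fst]
  exact h

/-- The two maps send the cliques of `Y` onto the same cliques, so the glued map stays bijective. -/
theorem exists_piecewise_iso (φ ψ : disjointCliques ι κ ≃g disjointCliques ι κ) (Y : Set ι)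
    (h : ∀ i ∈ Y, indexPerm φ i = indexPerm ψ i) :
    ∃ b : disjointCliques ι κ ≃g disjointCliques ι κ,
      (∀ x, x.1 ∈ Y → b x = φ x) ∧ ∀ x, x.1 ∉ Y → b x = ψ x := by
  classical
  set F : ι × κ → ι × κ := fun x => if x.1 ∈ Y then φ x else ψ x
  have hF : ∀ x, (F x).1 = indexPerm ψ x.1 := by
    intro x
    by_cases hx : x.1 ∈ Y
    · simp only [F, hx, if_true]; rw [← indexPerm_fst, h _ hx]
    · simp only [F, hx, if_false]; rw [← indexPerm_fst]
  have hbij : Function.Bijective F := by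
    constructor
    · intro x y hxy
      have h1 : x.1 = y.1 := (indexPerm ψ).injective (by rw [← hF, ← hF, hxy])
      by_cases hx : x.1 ∈ Y
      · have hy := h1 ▸ hx
        simp only [F, hx, hy, if_true] at hxy
        exact φ.injective hxy
      · have hy := h1 ▸ hx
        simp only [F, hx, hy, if_false] at hxy
        exact ψ.injective hxy
    · intro y
      by_cases hx : (ψ.symm y).1 ∈ Y
      · have h1 : (φ.symm y).1 = (ψ.symm y).1 := by
          apply (indexPerm φ).injective
          rw [h _ hx, indexPerm_fst, indexPerm_fst, RelIso.apply_symm_apply,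
            RelIso.apply_symm_apply]
        exact ⟨φ.symm y, by simp only [F, h1 ▸ hx, if_true, RelIso.apply_symm_apply]⟩
      · exact ⟨ψ.symm y, by simp only [F, hx, if_false, RelIso.apply_symm_apply]⟩
  refine ⟨cliquesIso (Equiv.ofBijective F hbij) fun x y => ?_, fun x hx => ?_, fun x hx => ?_⟩
  · change (F x).1 = (F y).1 ↔ _
    rw [hF, hF, (indexPerm ψ).injective.eq_iff]
  · change F x = _
    simp only [F, hx, if_true]
  · change F x = _
    simp only [F, hx, if_false]

/-- With v = g^N and u = g^(-N)h, it is enough to find `b` fixing the cliques of `A` with b u = f b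
v on `T`; then (b g b⁻¹)^N f (b g b⁻¹)^N equals `h` there. Such a `b` exists because v(T), u(T) and
`A` are disjoint for large `N` and `f` moves infinitely many cliques. -/
theorem omegaK_dense_step [Finite κ] {f h g : disjointCliques ι κ ≃g disjointCliques ι κ}
    (hf : {i | indexPerm f i ≠ i}.Infinite) (hg : g ∈ noFiniteOrbits (disjointCliques ι κ))
    (T A : Finset ι) (hTA : ∀ i ∈ T, i ∈ A) (hhT : ∀ i ∈ T, indexPerm h i ∈ A) :
    ∃ a : disjointCliques ι κ ≃g disjointCliques ι κ, (∀ x, x.1 ∈ A → a x = x) ∧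
      ∃ w ∈ Subgroup.closure {f, a⁻¹ * g * a}, ∀ x, x.1 ∈ T → w x = h x := by
  classical
  have := Fintype.ofFinite κ
  have hinf : ∀ X : Finset (ι × κ), ∀ x ∈ X, (autOrbit g x).Infinite := fun X x _ => hg x
  set full : Finset ι → Finset (ι × κ) := fun B => B ×ˢ Finset.univ
  have hfull : ∀ B x, x ∈ full B ↔ x.1 ∈ B := fun B x => by simp [full]
  set hT := T.image (indexPerm h)
  have hhTmem : ∀ x : ι × κ, x.1 ∈ T → (h x).1 ∈ hT := fun x hx =>
    Finset.mem_image.2 ⟨x.1, hx, indexPerm_fst h x⟩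
  obtain ⟨K₁, hK₁⟩ := eventually_zpow_ne (hinf (full T)) (full A)
  obtain ⟨K₂, hK₂⟩ := eventually_zpow_ne (hinf (full hT)) (full A)
  obtain ⟨K₃, hK₃⟩ := eventually_zpow_ne (hinf (full T)) (full hT)
  -- `K₁` and `K₂` push v(T) and u(T) off `A`; `K₃`, applied to 2N, separates v(T) from u(T).
  obtain ⟨N, hN⟩ : ∃ N : ℤ, N = K₁ + K₂ + K₃ := ⟨_, rfl⟩
  have hN0 : |N| = N := abs_of_nonneg (by omega)
  set v : disjointCliques ι κ ≃g disjointCliques ι κ := g ^ N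
  set u : disjointCliques ι κ ≃g disjointCliques ι κ := g ^ (-N) * h
  have hvA : ∀ x : ι × κ, x.1 ∈ T → (v x).1 ∉ A := fun x hx => by
    have := hK₁ N (by omega) x ((hfull _ _).2 hx)
    rwa [hfull] at this
  have huA : ∀ x : ι × κ, x.1 ∈ T → (u x).1 ∉ A := fun x hx => by
    have := hK₂ (-N) (by rw [abs_neg]; omega) (h x) ((hfull _ _).2 (hhTmem x hx))
    rwa [hfull] at this
  have hvu : ∀ x y : ι × κ, x.1 ∈ T → y.1 ∈ T → (v x).1 ≠ (u y).1 := fun x y hx hy e => by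
    have := hK₃ (2 * N) (by rw [abs_mul, hN0]; norm_num; omega) x ((hfull _ _).2 hx)
    rw [hfull] at this
    apply this
    rw [two_mul, zpow_add, RelIso.mul_apply]
    have e' := (fst_apply_eq_iff (g ^ N) _ _).2 e
    have : (g ^ N) (u y) = h y := by
      change (g ^ N * (g ^ (-N) * h)) y = _
      rw [← mul_assoc, ← zpow_add]; simp
    rw [this] at e'
    rw [show (g ^ N) ((g ^ N) x) = (g ^ N) (v x) from rfl, e']
    exact hhTmem y hy
  obtain ⟨k₀⟩ := ‹Nonempty κ›
  have hι : Nonempty ι := hf.nonempty.to_type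
  obtain ⟨z, hz, hzz⟩ := exists_fresh (indexPerm f) (fun _ : ι => {i | indexPerm f i ≠ i}) A T
    fun _ _ => hf
  have hvi : ∀ i, indexPerm v i = (v (i, k₀)).1 := fun i => indexPerm_fst v (i, k₀)
  have hui : ∀ i, indexPerm u i = (u (i, k₀)).1 := fun i => indexPerm_fst u (i, k₀)
  have hvA' : ∀ i ∈ T, indexPerm v i ∉ A := fun i hi => by rw [hvi]; exact hvA _ hi
  have huA' : ∀ i ∈ T, indexPerm u i ∉ A := fun i hi => by rw [hui]; exact huA _ hi
  have hvu' : ∀ i ∈ T, ∀ j ∈ T, indexPerm v i ≠ indexPerm u j := fun i hi j hj => by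
    rw [hvi, hui]; exact hvu _ _ hi hj
  have hvinj := fun i j => (indexPerm v).injective.eq_iff (a := i) (b := j)
  have huinj := fun i j => (indexPerm u).injective.eq_iff (a := i) (b := j)
  have hfinj := fun i j => (indexPerm f).injective.eq_iff (a := i) (b := j)
  obtain ⟨π, -, hπ⟩ := exists_perm_extending (fun _ : ι => ()) (fun _ => True) trivial
    (fun _ _ _ _ _ => trivial) (fun _ _ _ => rfl)
    (A.image (fun i => (i, i)) ∪ T.image (fun i => (indexPerm v i, z i)) ∪
      T.image fun i => (indexPerm u i, indexPerm f (z i))) (fun _ _ => rfl) (by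
    intro p hp r hr
    simp only [Finset.mem_union, Finset.mem_image] at hp hr
    rcases hp with (⟨i, hi, rfl⟩ | ⟨i, hi, rfl⟩) | ⟨i, hi, rfl⟩ <;>
    rcases hr with (⟨j, hj, rfl⟩ | ⟨j, hj, rfl⟩) | ⟨j, hj, rfl⟩ <;> simp only <;>
    have hzi := hz i <;> have hzj := hz j <;> have hzij := hzz i <;> have hzji := hzz j <;>
    simp only [mem_ofPred_eq] at hzi hzj <;>
    grind)
  simp only [Finset.mem_union, Finset.mem_image] at hπ
  set b₁ : disjointCliques ι κ ≃g disjointCliques ι κ :=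
    cliquesIso (π.prodCongr (Equiv.refl κ)) fun x y => by simp
  have hb₁ : ∀ x, b₁ x = (π x.1, x.2) := fun x => rfl
  -- `b₁` is right on cliques only. Replacing it over u(T) makes b u = f b v hold pointwise.
  obtain ⟨b, hbY, hbn⟩ := exists_piecewise_iso (f * b₁ * v * u⁻¹) b₁ (T.image (indexPerm u)) (by
    intro i hi
    obtain ⟨j, hj, rfl⟩ := Finset.mem_image.1 hi
    rw [hui, indexPerm_fst, indexPerm_fst]
    simp only [RelIso.mul_apply, RelIso.inv_apply_self]
    rw [← indexPerm_fst f, hb₁, hb₁, ← hvi, ← hui, hπ _ (Or.inl (Or.inr ⟨j, hj, rfl⟩)),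
      hπ _ (Or.inr ⟨j, hj, rfl⟩)])
  have hmem : ∀ x : ι × κ, x.1 ∈ T → (u x).1 ∈ T.image (indexPerm u) := fun x hx =>
    Finset.mem_image.2 ⟨x.1, hx, indexPerm_fst u x⟩
  have hbA : ∀ x, x.1 ∈ A → b x = x := by
    intro x hx
    rw [hbn, hb₁, hπ (x.1, x.1) (Or.inl (Or.inl ⟨_, hx, rfl⟩))]
    intro hx'
    obtain ⟨j, hj, hjx⟩ := Finset.mem_image.1 hx'
    exact huA' j hj (hjx ▸ hx)
  have hbv : ∀ x : ι × κ, x.1 ∈ T → b (v x) = b₁ (v x) := by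
    intro x hx
    refine hbn _ fun hx' => ?_
    obtain ⟨j, hj, hjx⟩ := Finset.mem_image.1 hx'
    rw [hui] at hjx
    exact hvu x (j, k₀) hx hj hjx.symm
  have hbu : ∀ x : ι × κ, x.1 ∈ T → b (u x) = f (b₁ (v x)) := by
    intro x hx
    rw [hbY _ (hmem x hx)]
    simp only [RelIso.mul_apply, RelIso.inv_apply_self]
  have hb' : ∀ x, x.1 ∈ A → b⁻¹ x = x := fun x hx => by
    conv_lhs => rw [← hbA x hx, RelIso.inv_apply_self]
  refine ⟨b⁻¹, hb', ?_⟩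
  have hpow : ∀ k : ℤ, (b⁻¹⁻¹ * g * b⁻¹) ^ k = b * g ^ k * b⁻¹ := fun k => by
    rw [inv_inv]; exact conj_zpow
  refine ⟨(b⁻¹⁻¹ * g * b⁻¹) ^ N * f * (b⁻¹⁻¹ * g * b⁻¹) ^ N,
    mul_mem (mul_mem (zpow_mem (Subgroup.subset_closure (by simp)) _)
      (Subgroup.subset_closure (by simp))) (zpow_mem (Subgroup.subset_closure (by simp)) _),
    fun x hx => ?_⟩
  rw [hpow]
  simp only [RelIso.mul_apply]
  rw [hb' x (hTA _ hx), show (g ^ N) x = v x from rfl, hbv x hx, ← hbu x hx,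
    RelIso.inv_apply_self]
  have : (g ^ N) (u x) = h x := by
    change (g ^ N * (g ^ (-N) * h)) x = _
    rw [← mul_assoc, ← zpow_add]; simp
  rw [this, hbA]
  rw [← indexPerm_fst]
  exact hhT _ hx

end DisjointCliques

theorem omegaK_comeagreIn {n : ℕ} (hn : 1 ≤ n) (f : omegaK n ≃g omegaK n)
    (hf : {c | componentPerm f c ≠ c}.Infinite) (S : Finset (ℕ × Fin n)) :
    ComeagreIn (denseMates f ∩ noFiniteOrbitsReps (omegaK n) (S : Set (ℕ × Fin n)))
      (noFiniteOrbitsReps (omegaK n) (S : Set (ℕ × Fin n))) := by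
  classical
  have : Nonempty (Fin n) := ⟨⟨0, hn⟩⟩
  refine comeagreIn_denseMates_of_forall f _ fun h t g hg s => ?_
  set T := t.image Prod.fst
  obtain ⟨a, ha, w, hw, hwT⟩ := omegaK_dense_step (h := h) (infinite_indexPerm_support f hf) hg.1 T
    (T ∪ T.image (indexPerm h) ∪ S.image Prod.fst ∪ s.image Prod.fst ∪
      (s.image g).image Prod.fst) (by simp +contextual) (by
        intro i hi
        have := Finset.mem_image_of_mem (indexPerm h) hi
        simp only [Finset.mem_union]; tauto)
  have hmem : ∀ (X : Finset (ℕ × Fin n)), ∀ x ∈ X, x.1 ∈ X.image Prod.fst := fun X x hx =>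
    Finset.mem_image_of_mem _ hx
  refine ⟨a⁻¹ * g * a, ⟨noFiniteOrbits_conj hg.1, isOrbitReps_conj hg.2 fun x hx => ha x ?_⟩,
    fun x hx => conj_apply_eq (ha x ?_) (ha _ ?_), w, hw, fun x hx => hwT x (hmem t x hx)⟩
  · have := hmem S x hx
    simp only [Finset.mem_union]; tauto
  · have := hmem s x hx
    simp only [Finset.mem_union]; tauto
  · have := hmem (s.image g) (g x) (Finset.mem_image_of_mem _ hx)
    simp only [Finset.mem_union]; tauto

/-! ### Neumann's lemma on moving finite sets -/

section Neumann

open scoped Pointwise in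
/-- B. H. Neumann: finitely many points with infinite orbits can be moved off any finite set. -/
theorem exists_smul_notMem {Γ α : Type*} [Group Γ] [MulAction Γ α] (S T : Finset α)
    (hS : ∀ x ∈ S, (MulAction.orbit Γ x).Infinite) : ∃ γ : Γ, ∀ x ∈ S, γ • x ∉ T := by
  classical
  by_contra! hcon
  have hch : ∀ p : α × α, ∃ γ : Γ, p.2 ∈ MulAction.orbit Γ p.1 → γ • p.1 = p.2 := fun p => by
    by_cases h : p.2 ∈ MulAction.orbit Γ p.1
    · obtain ⟨γ, hγ⟩ := h
      exact ⟨γ, fun _ => hγ⟩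
    · exact ⟨1, fun h' => absurd h' h⟩
  choose c hc using hch
  -- If every element sends some point of `S` into `T`, finitely many cosets of point stabilisers
  -- cover the group. One stabiliser then has finite index, contradicting an infinite orbit.
  have hcov : ⋃ p ∈ S ×ˢ T, c p • (MulAction.stabilizer Γ p.1 : Set Γ) = Set.univ := by
    refine Set.eq_univ_of_forall fun γ => ?_
    obtain ⟨x, hx, hy⟩ := hcon γ
    refine Set.mem_iUnion₂.2 ⟨(x, γ • x), Finset.mem_product.2 ⟨hx, hy⟩, ?_⟩
    rw [mem_leftCoset_iff, SetLike.mem_coe, MulAction.mem_stabilizer_iff, mul_smul,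
      inv_smul_eq_iff]
    exact (hc (x, γ • x) ⟨γ, rfl⟩).symm
  obtain ⟨p, hp, hfin⟩ := Subgroup.exists_finiteIndex_of_leftCoset_cover hcov
  refine hS p.1 (Finset.mem_product.1 hp).1 ?_
  have : Finite (Γ ⧸ MulAction.stabilizer Γ p.1) := Subgroup.finite_quotient_of_finiteIndex
  have := Finite.of_equiv _ (MulAction.orbitEquivQuotientStabilizer Γ p.1).symm
  exact Set.toFinite _

end Neumann

/-! ### Component permutations and orbits of the generated group -/

section Clusters

variable {V : Type*} {G : SimpleGraph V}

/-- The action of automorphisms on connected components, as a homomorphism. -/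
def componentHom (G : SimpleGraph V) : (G ≃g G) →* Equiv.Perm G.ConnectedComponent where
  toFun := componentPerm
  map_one' := by
    ext c
    induction c using SimpleGraph.ConnectedComponent.ind
    rfl
  map_mul' f g := by
    ext c
    induction c using SimpleGraph.ConnectedComponent.ind
    rfl

theorem componentHom_mk (f : G ≃g G) (x : V) :
    componentHom G f (G.connectedComponentMk x) = G.connectedComponentMk (f x) := rfl

theorem mk_apply_of_componentHom_eq_one {f : G ≃g G} (hf : componentHom G f = 1) (x : V) :
    G.connectedComponentMk (f x) = G.connectedComponentMk x := by
  rw [← componentHom_mk, hf]; rfl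

theorem componentHom_eq_of_forall {f g : G ≃g G}
    (h : ∀ x, G.connectedComponentMk (f x) = G.connectedComponentMk (g x)) :
    componentHom G f = componentHom G g := by
  refine Equiv.ext fun c => ?_
  induction c using SimpleGraph.ConnectedComponent.ind with | _ x
  exact h x

theorem exists_mem_closure_componentHom_eq {f g : G ≃g G} (hg : g ∈ componentMates f)
    (σ : Equiv.Perm G.ConnectedComponent) :
    ∃ w ∈ Subgroup.closure {f, g}, componentHom G w = σ := by
  have h : (Subgroup.closure {f, g}).map (componentHom G) = ⊤ := by
    rw [MonoidHom.map_closure, image_pair]; exact hg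
  have : σ ∈ (Subgroup.closure {f, g}).map (componentHom G) := h ▸ Subgroup.mem_top σ
  exact this

theorem componentMates_conj {f a g : G ≃g G} (ha : componentHom G a = 1)
    (hg : g ∈ componentMates f) : a⁻¹ * g * a ∈ componentMates f := by
  have : componentPerm (a⁻¹ * g * a) = componentPerm g := by
    change componentHom G _ = componentHom G _
    simp [ha]
  rw [componentMates, Set.mem_ofPred_eq, this]
  exact hg

/-- A permutation fixing every component, as an automorphism of a disjoint union of cliques. -/
def clusterIso (hG : ∀ x y, G.Adj x y ↔ x ≠ y ∧ G.connectedComponentMk x = G.connectedComponentMk y)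
    (e : Equiv.Perm V) (h : ∀ x, G.connectedComponentMk (e x) = G.connectedComponentMk x) :
    G ≃g G where
  toEquiv := e
  map_rel_iff' {x y} := by rw [hG, hG, h, h, e.injective.ne_iff]

/-- The component `L` is fixed pointwise by `f`, up to finitely many points. -/
def AlmostFixed (f : G ≃g G) (L : G.ConnectedComponent) : Prop :=
  {x | G.connectedComponentMk x = L ∧ f x ≠ x}.Finite

theorem AlmostFixed.infinite_fixed {f : G ≃g G} {L : G.ConnectedComponent}
    (hL : AlmostFixed f L) (hinf : L.supp.Infinite) :
    {x | G.connectedComponentMk x = L ∧ f x = x}.Infinite := by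
  refine (hinf.sdiff hL).mono fun x hx => ?_
  have h1 : G.connectedComponentMk x = L := hx.1
  refine ⟨h1, ?_⟩
  by_contra h
  exact hx.2 ⟨h1, h⟩

theorem AlmostFixed.componentHom_eq {f : G ≃g G} {L : G.ConnectedComponent}
    (hL : AlmostFixed f L) (hinf : L.supp.Infinite) : componentHom G f L = L := by
  obtain ⟨x, rfl, hx⟩ := (hL.infinite_fixed hinf).nonempty
  rw [componentHom_mk, hx]

/-- A finite orbit is `f`-invariant, and elements of the group swap any two components while
preserving it. It would meet all components in equally many points. -/
theorem infinite_orbit_closure {f g : G ≃g G} (hg : g ∈ componentMates f)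
    (hf : ∀ Γ : Set V, Γ.Finite → Γ.Nonempty → f '' Γ = Γ →
      ∃ L L' : G.ConnectedComponent, (L.supp ∩ Γ).ncard ≠ (L'.supp ∩ Γ).ncard) (x : V) :
    (MulAction.orbit (Subgroup.closure {f, g}) x).Infinite := by
  classical
  intro hfin
  have himg : ∀ w ∈ Subgroup.closure {f, g},
      w '' MulAction.orbit (Subgroup.closure {f, g}) x =
        MulAction.orbit (Subgroup.closure {f, g}) x := fun w hw =>
    MulAction.smul_orbit (⟨w, hw⟩ : Subgroup.closure {f, g}) x
  obtain ⟨L, L', hL⟩ := hf _ hfin (MulAction.nonempty_orbit x)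
    (himg f (Subgroup.subset_closure (by simp)))
  obtain ⟨w, hw, hwL⟩ := exists_mem_closure_componentHom_eq hg (Equiv.swap L L')
  refine hL ?_
  have hsupp : L'.supp = w '' L.supp := by
    ext y
    obtain ⟨y, rfl⟩ := w.surjective y
    rw [w.injective.mem_set_image]
    change G.connectedComponentMk (w y) = L' ↔ G.connectedComponentMk y = L
    rw [← componentHom_mk, hwL, ← Equiv.eq_symm_apply, Equiv.symm_swap, Equiv.swap_apply_right]
  rw [hsupp]
  conv_rhs => rw [← himg w hw]
  rw [← image_inter w.injective, ncard_image_of_injective _ w.injective]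

/-- Neumann's lemma is applied to the translates of `T` by inverses of chosen representatives of all
component permutations. The element found can then be corrected by a representative to act trivially
on components. -/
theorem exists_mem_closure_notMem [Finite G.ConnectedComponent] {f g : G ≃g G}
    (hg : g ∈ componentMates f)
    (hf : ∀ Γ : Set V, Γ.Finite → Γ.Nonempty → f '' Γ = Γ →
      ∃ L L' : G.ConnectedComponent, (L.supp ∩ Γ).ncard ≠ (L'.supp ∩ Γ).ncard) (S T : Finset V) :
    ∃ w ∈ Subgroup.closure {f, g}, componentHom G w = 1 ∧ ∀ x ∈ S, w x ∉ T := by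
  classical
  have := Fintype.ofFinite G.ConnectedComponent
  choose v hv hvσ using exists_mem_closure_componentHom_eq hg
  obtain ⟨w, hw⟩ := exists_smul_notMem (Γ := Subgroup.closure {f, g}) S
    (Finset.univ.biUnion fun σ : Equiv.Perm G.ConnectedComponent =>
      T.image ((v σ)⁻¹ : G ≃g G)) fun x _ => infinite_orbit_closure hg hf x
  refine ⟨v (componentHom G w)⁻¹ * w, mul_mem (hv _) w.2, by simp [hvσ], fun x hx hT => hw x hx ?_⟩
  refine Finset.mem_biUnion.2 ⟨(componentHom G w)⁻¹, Finset.mem_univ _,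
    Finset.mem_image.2 ⟨_, hT, ?_⟩⟩
  rw [RelIso.mul_apply, RelIso.inv_apply_self]
  rfl

/-- A finite set of representatives means finitely many orbits, so the finite ones have finite
union. -/
theorem finite_setOf_finite_orbit {g : G ≃g G} {S : Finset V} (hS : IsOrbitReps (S : Set V) g) :
    {x | (autOrbit g x).Finite}.Finite := by
  refine ((S.finite_toSet.sep fun x => (autOrbit g x).Finite).biUnion
    (t := fun x => autOrbit g x) fun x hx => hx.2).subset fun x hx => ?_
  obtain ⟨y, ⟨hyS, ⟨k, hk⟩⟩, -⟩ := hS x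
  have hk' : (g ^ k) x = y := hk
  have hsub : ∀ m : ℤ, (g ^ m) y = (g ^ (m + k)) x := fun m => by
    rw [zpow_add, RelIso.mul_apply, hk']
  refine mem_iUnion₂.2 ⟨y, ⟨hyS, Finite.subset hx ?_⟩, ⟨-k, ?_⟩⟩
  · rintro _ ⟨m, rfl⟩
    exact ⟨m + k, (hsub m).symm⟩
  · change (g ^ (-k)) y = x
    rw [hsub]; simp

end Clusters

/-! ### The case of nK_ω: reachable targets and generation -/

section ClusterGeneration

variable {V : Type*} {G : SimpleGraph V}

theorem mk_swap_apply [DecidableEq V] {x y : V}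
    (hxy : G.connectedComponentMk x = G.connectedComponentMk y) (z : V) :
    G.connectedComponentMk (Equiv.swap x y z) = G.connectedComponentMk z := by
  rw [Equiv.swap_apply_def]
  split_ifs with h1 h2
  · rw [h1, hxy]
  · rw [h2, hxy]
  · rfl

theorem exists_componentwise_perm (q : Finset (V × V))
    (hc : ∀ p ∈ q, G.connectedComponentMk p.1 = G.connectedComponentMk p.2)
    (hinj : ∀ p ∈ q, ∀ r ∈ q, p.1 = r.1 ↔ p.2 = r.2) :
    ∃ e : Equiv.Perm V, (∀ x, G.connectedComponentMk (e x) = G.connectedComponentMk x) ∧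
      ∀ p ∈ q, e p.1 = p.2 := by
  classical
  exact exists_perm_extending (fun x => G.connectedComponentMk x) _ (fun _ => rfl)
    (fun e x y hxy he u => (mk_swap_apply hxy _).trans (he u)) (fun e he => he) q hc hinj

-- After `w₁` moves everything to infinite `g`-orbits, `g ^ N` carries the points far out, where a
-- conjugator `b` is free to identify the action of `h` with that of `f` on fresh points `z`. The
-- conditions on `h` match the available `z`: fixed by `f` in almost fixed components, moved
-- elsewhere.
set_option maxHeartbeats 1000000 in
theorem cluster_dense_step [Finite G.ConnectedComponent]
    (hG : ∀ x y, G.Adj x y ↔ x ≠ y ∧ G.connectedComponentMk x = G.connectedComponentMk y)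
    (hinf : ∀ L : G.ConnectedComponent, L.supp.Infinite) {f g h : G ≃g G}
    (hf : ∀ Γ : Set V, Γ.Finite → Γ.Nonempty → f '' Γ = Γ →
      ∃ L L' : G.ConnectedComponent, (L.supp ∩ Γ).ncard ≠ (L'.supp ∩ Γ).ncard)
    (hg : g ∈ componentMates f) {S : Finset V} (hS : IsOrbitReps (S : Set V) g)
    (hh : componentHom G h = componentHom G f) (t A : Finset V)
    (hfix : ∀ x ∈ t, AlmostFixed f (G.connectedComponentMk x) → h x = x)
    (hmove : ∀ x ∈ t, ¬ AlmostFixed f (G.connectedComponentMk x) → h x ∉ t) :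
    ∃ a : G ≃g G, (∀ x ∈ A, a x = x) ∧ componentHom G a = 1 ∧
      ∃ w ∈ Subgroup.closure {f, a⁻¹ * g * a}, ∀ x ∈ t, w x = h x := by
  classical
  rcases t.eq_empty_or_nonempty with rfl | ⟨t₀, -⟩
  · exact ⟨1, fun _ _ => rfl, map_one _, 1, one_mem _, by simp⟩
  have : Nonempty V := ⟨t₀⟩
  obtain ⟨w₁, hw₁, hw₁c, hw₁fin⟩ := exists_mem_closure_notMem hg hf (t ∪ t.image h)
    (finite_setOf_finite_orbit hS).toFinset
  simp only [Finite.mem_toFinset, Set.mem_ofPred_eq] at hw₁fin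
  obtain ⟨A₁, hA₁⟩ := exists_finset_of_mem_closure f g hw₁ (t ∪ t.image h)
  set R := (t ∪ t.image h).image w₁
  have hR : ∀ x ∈ R, (autOrbit g x).Infinite := by
    intro x hx
    obtain ⟨y, hy, rfl⟩ := Finset.mem_image.1 hx
    exact hw₁fin y hy
  -- Fixing `A₁` and its `g`-image keeps `g` unchanged on `A₁`, so the word `w₁` survives the
  -- conjugation on the relevant points.
  set B := A ∪ A₁ ∪ A₁.image g ∪ R
  obtain ⟨K, hK⟩ := eventually_zpow_ne hR B
  obtain ⟨d, hd, hgd⟩ : ∃ d : ℕ, 0 < d ∧ componentHom G g ^ d = 1 :=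
    ⟨_, orderOf_pos _, pow_orderOf_eq_one _⟩
  -- A multiple of the order of the component permutation, so that `g ^ N` preserves every
  -- component.
  set N : ℤ := d * K
  have hN : (K : ℤ) ≤ |N| := by
    rw [abs_of_nonneg (by positivity)]
    exact le_mul_of_one_le_left (by positivity) (by exact_mod_cast hd)
  set v : G ≃g G := g ^ N
  have hvc : componentHom G v = 1 := by
    rw [map_zpow, zpow_mul, zpow_natCast, zpow_natCast, hgd, one_pow]
  set h₁ : G ≃g G := w₁ * h * w₁⁻¹
  have hh₁ : componentHom G h₁ = componentHom G f := by simp [h₁, hw₁c, hh]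
  set t₁ := t.image w₁
  have ht₁R : ∀ x ∈ t₁, x ∈ R := fun x hx => by
    obtain ⟨y, hy, rfl⟩ := Finset.mem_image.1 hx
    exact Finset.mem_image_of_mem _ (Finset.mem_union_left _ hy)
  have hh₁w : ∀ y, h₁ (w₁ y) = w₁ (h y) := fun y => by
    simp only [h₁, RelIso.mul_apply, RelIso.inv_apply_self]
  have hh₁R : ∀ x ∈ t₁, h₁ x ∈ R := fun x hx => by
    obtain ⟨y, hy, rfl⟩ := Finset.mem_image.1 hx
    rw [hh₁w]
    exact Finset.mem_image_of_mem _ (Finset.mem_union_right _ (Finset.mem_image_of_mem _ hy))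
  have hfix₁ : ∀ x ∈ t₁, AlmostFixed f (G.connectedComponentMk x) → h₁ x = x := by
    intro x hx hxf
    obtain ⟨y, hy, rfl⟩ := Finset.mem_image.1 hx
    rw [mk_apply_of_componentHom_eq_one hw₁c] at hxf
    rw [hh₁w, hfix y hy hxf]
  have hmove₁ : ∀ x ∈ t₁, ∀ y ∈ t₁, ¬ AlmostFixed f (G.connectedComponentMk x) → h₁ x ≠ y := by
    intro x hx y' hy' hxf
    obtain ⟨y, hy, rfl⟩ := Finset.mem_image.1 hx
    obtain ⟨y', hy'', rfl⟩ := Finset.mem_image.1 hy'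
    rw [mk_apply_of_componentHom_eq_one hw₁c] at hxf
    rw [hh₁w]
    exact fun e => hmove y hy hxf (by rwa [w₁.injective e])
  obtain ⟨z, hz, hzz⟩ := exists_fresh f.toEquiv (fun x => {y |
    G.connectedComponentMk y = G.connectedComponentMk x ∧
      (f y = y ↔ AlmostFixed f (G.connectedComponentMk x))}) B t₁ (by
    intro x _
    by_cases hx : AlmostFixed f (G.connectedComponentMk x)
    · simpa only [hx, iff_true] using hx.infinite_fixed (hinf _)
    · simp only [hx, iff_false]
      exact hx)
  have hzf : ∀ x, f.toEquiv x = f x := fun _ => rfl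
  simp only [hzf, Set.mem_ofPred_eq] at hz hzz
  have hvB : ∀ x ∈ R, v x ∉ B := hK N hN
  have hvB₁ : ∀ x ∈ t₁, v x ∉ B := fun x hx => hvB x (ht₁R x hx)
  have hvB₂ : ∀ x ∈ t₁, v (h₁ x) ∉ B := fun x hx => hvB _ (hh₁R x hx)
  have hvi := fun x y => v.injective.eq_iff (a := x) (b := y)
  have hhi := fun x y => h₁.injective.eq_iff (a := x) (b := y)
  have hfi := fun x y => f.injective.eq_iff (a := x) (b := y)
  obtain ⟨e, he, hq⟩ := exists_componentwise_perm (G := G)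
    (B.image (fun x => (x, x)) ∪ t₁.image (fun x => (v x, z x)) ∪
      t₁.image fun x => (v (h₁ x), f (z x))) (by
    intro p hp
    simp only [Finset.mem_union, Finset.mem_image] at hp
    rcases hp with (⟨x, hx, rfl⟩ | ⟨x, hx, rfl⟩) | ⟨x, hx, rfl⟩
    · rfl
    · simp only [mk_apply_of_componentHom_eq_one hvc, (hz x hx).1]
    · simp only [mk_apply_of_componentHom_eq_one hvc]
      rw [← componentHom_mk, ← componentHom_mk, (hz x hx).1.1, hh₁]) (by
    intro p hp r hr
    simp only [Finset.mem_union, Finset.mem_image] at hp hr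
    rcases hp with (⟨x, hx, rfl⟩ | ⟨x, hx, rfl⟩) | ⟨x, hx, rfl⟩ <;>
    rcases hr with (⟨y, hy, rfl⟩ | ⟨y, hy, rfl⟩) | ⟨y, hy, rfl⟩ <;> simp only <;>
    have hzx := hz x <;> have hzy := hz y <;> have hzxy := hzz x <;> have hzyx := hzz y <;>
    grind)
  simp only [Finset.mem_union, Finset.mem_image] at hq
  set b : G ≃g G := clusterIso hG e he
  have hb : ∀ x, b x = e x := fun _ => rfl
  have hbB : ∀ x ∈ B, b x = x := fun x hx => hq (x, x) (Or.inl (Or.inl ⟨x, hx, rfl⟩))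
  have hb' : ∀ x ∈ B, b⁻¹ x = x := fun x hx => by
    conv_lhs => rw [← hbB x hx, RelIso.inv_apply_self]
  have hRB : ∀ x ∈ R, x ∈ B := fun x hx => Finset.mem_union_right _ hx
  obtain ⟨w', hw', hw'w⟩ := hA₁ (b⁻¹⁻¹ * g * b⁻¹) fun x hx => by
    refine conj_apply_eq (hb' _ ?_) (hb' _ ?_)
    · simp only [B, Finset.mem_union]; tauto
    · have := Finset.mem_image_of_mem g hx
      simp only [B, Finset.mem_union]; tauto
  refine ⟨b⁻¹, fun x hx => hb' x ?_, ?_, ?_⟩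
  · simp only [B, Finset.mem_union]; tauto
  · rw [map_inv, inv_eq_one, ← map_one (componentHom G)]
    exact componentHom_eq_of_forall he
  have hpow : ∀ k : ℤ, (b⁻¹⁻¹ * g * b⁻¹) ^ k = b * g ^ k * b⁻¹ := fun k => by
    rw [inv_inv]; exact conj_zpow
  refine ⟨w'⁻¹ * (b⁻¹⁻¹ * g * b⁻¹) ^ (-N) * f * (b⁻¹⁻¹ * g * b⁻¹) ^ N * w',
    mul_mem (mul_mem (mul_mem (mul_mem (inv_mem hw') (zpow_mem (Subgroup.subset_closure (by simp)) _))
      (Subgroup.subset_closure (by simp))) (zpow_mem (Subgroup.subset_closure (by simp)) _)) hw',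
    fun x hx => ?_⟩
  have hx₁ : w₁ x ∈ t₁ := Finset.mem_image_of_mem _ hx
  have e1 : b (v (w₁ x)) = z (w₁ x) := hq (_, _) (Or.inl (Or.inr ⟨_, hx₁, rfl⟩))
  have e2 : b (v (h₁ (w₁ x))) = f (z (w₁ x)) := hq (_, _) (Or.inr ⟨_, hx₁, rfl⟩)
  have e3 : (g ^ (-N)) (v (h₁ (w₁ x))) = h₁ (w₁ x) := by
    rw [← RelIso.mul_apply, ← zpow_add, neg_add_cancel]; rfl
  rw [hpow, hpow]
  simp only [RelIso.mul_apply]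
  rw [hw'w x (Finset.mem_union_left _ hx), hb' _ (hRB _ (ht₁R _ hx₁)),
    show (g ^ N) (w₁ x) = v (w₁ x) from rfl, e1, ← e2, RelIso.inv_apply_self, e3,
    hbB _ (hRB _ (hh₁R _ hx₁)), hh₁w,
    ← hw'w _ (Finset.mem_union_right _ (Finset.mem_image_of_mem _ hx)), RelIso.inv_apply_self]

/-- `k` lies in the closure of the group generated by `f` and `g`. -/
def Approximable (f g k : G ≃g G) : Prop :=
  ∀ t : Finset V, ∃ w ∈ Subgroup.closure {f, g}, ∀ x ∈ t, w x = k x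

theorem Approximable.of_mem {f g k : G ≃g G} (hk : k ∈ Subgroup.closure {f, g}) :
    Approximable f g k := fun _ => ⟨k, hk, fun _ _ => rfl⟩

theorem Approximable.mul {f g k l : G ≃g G} (hk : Approximable f g k) (hl : Approximable f g l) :
    Approximable f g (k * l) := by
  classical
  intro t
  obtain ⟨w₁, hw₁, h₁⟩ := hk (t.image l)
  obtain ⟨w₂, hw₂, h₂⟩ := hl t
  refine ⟨w₁ * w₂, mul_mem hw₁ hw₂, fun x hx => ?_⟩
  rw [RelIso.mul_apply, RelIso.mul_apply, h₂ x hx, h₁ _ (Finset.mem_image_of_mem _ hx)]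

/-- Compose `f` with a component-preserving permutation sending `f x` back to `x` in almost fixed
components, and to a fresh point of its component otherwise. -/
theorem exists_componentHom_eq_moving
    (hG : ∀ x y, G.Adj x y ↔ x ≠ y ∧ G.connectedComponentMk x = G.connectedComponentMk y)
    (hinf : ∀ L : G.ConnectedComponent, L.supp.Infinite) (f : G ≃g G) (t : Finset V) :
    ∃ h : G ≃g G, componentHom G h = componentHom G f ∧
      (∀ x ∈ t, AlmostFixed f (G.connectedComponentMk x) → h x = x) ∧
      ∀ x ∈ t, ¬ AlmostFixed f (G.connectedComponentMk x) → h x ∉ t := by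
  classical
  rcases t.eq_empty_or_nonempty with rfl | ⟨t₀, -⟩
  · exact ⟨f, rfl, by simp, by simp⟩
  have : Nonempty V := ⟨t₀⟩
  obtain ⟨y, hy, hyy⟩ := exists_fresh (Equiv.refl V)
    (fun x => (G.connectedComponentMk (f x)).supp) t t fun x _ => hinf _
  set q : Finset (V × V) := t.image fun x =>
    (f x, if AlmostFixed f (G.connectedComponentMk x) then x else y x)
  have hfi := fun x y => f.injective.eq_iff (a := x) (b := y)
  obtain ⟨e, he, hq⟩ := exists_componentwise_perm (G := G) q (by
    intro p hp
    obtain ⟨x, hx, rfl⟩ := Finset.mem_image.1 hp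
    by_cases h : AlmostFixed f (G.connectedComponentMk x)
    · simp only [h, if_true]
      rw [← componentHom_mk, h.componentHom_eq (hinf _)]
    · simp only [h, if_false]
      exact (hy x hx).1.symm) (by
    intro p hp r hr
    obtain ⟨x, hx, rfl⟩ := Finset.mem_image.1 hp
    obtain ⟨u, hu, rfl⟩ := Finset.mem_image.1 hr
    simp only
    have h1 := hy x hx
    have h2 := hy u hu
    have h3 := hyy x hx u hu
    grind)
  have hq' : ∀ x ∈ t, e (f x) = if AlmostFixed f (G.connectedComponentMk x) then x else y x :=
    fun x hx => hq _ (Finset.mem_image_of_mem _ hx)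
  have he1 : componentHom G (clusterIso hG e he) = 1 := by
    rw [← map_one (componentHom G)]
    exact componentHom_eq_of_forall he
  refine ⟨clusterIso hG e he * f, by rw [map_mul, he1, one_mul], fun x hx h => ?_,
    fun x hx h => ?_⟩
  · exact (hq' x hx).trans (if_pos h)
  · rw [show (clusterIso hG e he * f) x = y x from (hq' x hx).trans (if_neg h)]
    exact (hy x hx).2.1

/-- Otherwise one fixed point from each component would form a finite invariant set meeting all
components equally. -/
theorem exists_not_almostFixed [Finite G.ConnectedComponent] [Nonempty V]
    (hinf : ∀ L : G.ConnectedComponent, L.supp.Infinite) {f : G ≃g G}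
    (hf : ∀ Γ : Set V, Γ.Finite → Γ.Nonempty → f '' Γ = Γ →
      ∃ L L' : G.ConnectedComponent, (L.supp ∩ Γ).ncard ≠ (L'.supp ∩ Γ).ncard) :
    ∃ L, ¬ AlmostFixed f L := by
  by_contra! hcon
  choose y hyL hyf using fun L => ((hcon L).infinite_fixed (hinf L)).nonempty
  have hone : ∀ L : G.ConnectedComponent, L.supp ∩ range y = {y L} := by
    intro L
    ext x
    constructor
    · rintro ⟨hx, L', rfl⟩
      have : L' = L := (hyL L').symm.trans hx
      rw [this]; rfl
    · rintro rfl
      exact ⟨hyL L, L, rfl⟩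
  obtain ⟨L, L', h⟩ := hf (range y) (finite_range y)
    ⟨_, mem_range_self (G.connectedComponentMk (Classical.arbitrary V))⟩ (by
      rw [← range_comp]
      congr 1
      exact funext hyf)
  exact h (by rw [hone, hone, ncard_singleton, ncard_singleton])

theorem cluster_approximable [Finite G.ConnectedComponent] [Nonempty V]
    (hG : ∀ x y, G.Adj x y ↔ x ≠ y ∧ G.connectedComponentMk x = G.connectedComponentMk y)
    (hinf : ∀ L : G.ConnectedComponent, L.supp.Infinite) {f g : G ≃g G}
    (hf : ∀ Γ : Set V, Γ.Finite → Γ.Nonempty → f '' Γ = Γ →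
      ∃ L L' : G.ConnectedComponent, (L.supp ∩ Γ).ncard ≠ (L'.supp ∩ Γ).ncard)
    (hg : g ∈ componentMates f)
    (H : ∀ (h : G ≃g G) (t : Finset V), componentHom G h = componentHom G f →
      (∀ x ∈ t, AlmostFixed f (G.connectedComponentMk x) → h x = x) →
      (∀ x ∈ t, ¬ AlmostFixed f (G.connectedComponentMk x) → h x ∉ t) →
      ∃ w ∈ Subgroup.closure {f, g}, ∀ x ∈ t, w x = h x) (h : G ≃g G) :
    Approximable f g h := by
  classical
  -- Both `u * k` on `t` and `u` on k(t) are admissible targets, and their quotient is `k`.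
  have fixing : ∀ k : G ≃g G, componentHom G k = 1 →
      (∀ x, AlmostFixed f (G.connectedComponentMk x) → k x = x) → Approximable f g k := by
    intro k hk hkf t
    obtain ⟨u, hu, huf, hum⟩ := exists_componentHom_eq_moving hG hinf f (t ∪ t.image k)
    have hkx : ∀ x ∈ t, k x ∈ t ∪ t.image k := fun x hx =>
      Finset.mem_union_right _ (Finset.mem_image_of_mem _ hx)
    have hkc := mk_apply_of_componentHom_eq_one hk
    obtain ⟨w₁, hw₁, h₁⟩ := H (u * k) t (by rw [map_mul, hk, mul_one, hu])
      (fun x hx hxf => by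
        rw [RelIso.mul_apply, huf _ (hkx x hx) (by rwa [hkc]), hkf x hxf])
      (fun x hx hxf hc => hum _ (hkx x hx) (by rwa [hkc]) (Finset.mem_union_left _ hc))
    obtain ⟨w₂, hw₂, h₂⟩ := H u (t.image k) hu
      (fun x hx => huf x (Finset.mem_union_right _ hx))
      (fun x hx hxf hc => hum x (Finset.mem_union_right _ hx) hxf (Finset.mem_union_right _ hc))
    refine ⟨w₂⁻¹ * w₁, mul_mem (inv_mem hw₂) hw₁, fun x hx => ?_⟩
    rw [RelIso.mul_apply, h₁ x hx, RelIso.mul_apply, ← h₂ _ (Finset.mem_image_of_mem _ hx),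
      RelIso.inv_apply_self]
  obtain ⟨L, hL⟩ := exists_not_almostFixed hinf hf
  -- A transposition inside `L` is covered by `fixing`; conjugating by an element taking `L` to the
  -- component of `x` gives the others.
  have swaps : ∀ x y (hxy : G.connectedComponentMk x = G.connectedComponentMk y),
      Approximable f g (clusterIso hG (Equiv.swap x y) (mk_swap_apply hxy)) := by
    intro x y hxy
    obtain ⟨w, hw, hwL⟩ := exists_mem_closure_componentHom_eq hg
      (Equiv.swap L (G.connectedComponentMk x))
    have hw' : ∀ z, G.connectedComponentMk z = G.connectedComponentMk x →
        G.connectedComponentMk (w⁻¹ z) = L := fun z hz => by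
      apply (componentHom G w).injective
      rw [componentHom_mk, RelIso.apply_inv_self, hwL, Equiv.swap_apply_left, hz]
    have hxy' : G.connectedComponentMk (w⁻¹ x) = G.connectedComponentMk (w⁻¹ y) :=
      (hw' x rfl).trans (hw' y hxy.symm).symm
    have := ((Approximable.of_mem hw).mul (fixing (clusterIso hG (Equiv.swap (w⁻¹ x) (w⁻¹ y))
      (mk_swap_apply hxy')) ?_ ?_)).mul (Approximable.of_mem (inv_mem hw))
    · convert this using 1
      ext z
      change Equiv.swap x y z = w (Equiv.swap (w⁻¹ x) (w⁻¹ y) (w⁻¹ z))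
      rw [Equiv.swap_apply_def, Equiv.swap_apply_def]
      simp only [EmbeddingLike.apply_eq_iff_eq]
      split_ifs <;> simp
    · rw [← map_one (componentHom G)]
      exact componentHom_eq_of_forall (mk_swap_apply hxy')
    · intro z hz
      refine Equiv.swap_apply_of_ne_of_ne ?_ ?_
      · rintro rfl
        rw [hw' x rfl] at hz
        exact hL hz
      · rintro rfl
        rw [hw' y hxy.symm] at hz
        exact hL hz
  -- Dividing by `w₀` leaves a map preserving each component, which agrees on `t` with a product of
  -- transpositions.
  obtain ⟨w₀, hw₀, hw₀h⟩ := exists_mem_closure_componentHom_eq hg (componentHom G h)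
  have hk : componentHom G (w₀⁻¹ * h) = 1 := by simp [hw₀h]
  intro t
  obtain ⟨e, ⟨he, hea⟩, hq⟩ := exists_perm_extending (fun x => G.connectedComponentMk x)
    (fun e : Equiv.Perm V =>
      ∃ he : ∀ x, G.connectedComponentMk (e x) = G.connectedComponentMk x,
        Approximable f g (clusterIso hG e he))
    ⟨fun _ => rfl, Approximable.of_mem (one_mem _)⟩
    (fun e x y hxy ⟨he, hea⟩ => ⟨fun z => (mk_swap_apply hxy _).trans (he z),
      (swaps x y hxy).mul hea⟩) (fun e he => he.1) (t.image fun x => (x, (w₀⁻¹ * h) x)) (by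
    intro p hp
    obtain ⟨x, -, rfl⟩ := Finset.mem_image.1 hp
    exact (mk_apply_of_componentHom_eq_one hk x).symm) (by
    intro p hp r hr
    obtain ⟨x, -, rfl⟩ := Finset.mem_image.1 hp
    obtain ⟨y, -, rfl⟩ := Finset.mem_image.1 hr
    exact (w₀⁻¹ * h).injective.eq_iff.symm)
  obtain ⟨w, hw, hwt⟩ := (Approximable.of_mem hw₀).mul hea t
  refine ⟨w, hw, fun x hx => (hwt x hx).trans ?_⟩
  have : e x = (w₀⁻¹ * h) x := hq _ (Finset.mem_image_of_mem _ hx)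
  change w₀ (e x) = h x
  rw [this, RelIso.mul_apply, RelIso.apply_inv_self]

theorem cluster_comeagreIn [Finite G.ConnectedComponent] [Nonempty V] [Countable V]
    (hG : ∀ x y, G.Adj x y ↔ x ≠ y ∧ G.connectedComponentMk x = G.connectedComponentMk y)
    (hinf : ∀ L : G.ConnectedComponent, L.supp.Infinite) (f : G ≃g G)
    (hf : ∀ Γ : Set V, Γ.Finite → Γ.Nonempty → f '' Γ = Γ →
      ∃ L L' : G.ConnectedComponent, (L.supp ∩ Γ).ncard ≠ (L'.supp ∩ Γ).ncard)
    (S : Finset V) :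
    ComeagreIn (denseMates f ∩ componentMatesReps f (S : Set V))
      (componentMatesReps f (S : Set V)) := by
  classical
  refine comeagreIn_denseMates f _ {q | ∃ (h : G ≃g G) (t : Finset V),
      componentHom G h = componentHom G f ∧
      (∀ x ∈ t, AlmostFixed f (G.connectedComponentMk x) → h x = x) ∧
      (∀ x ∈ t, ¬ AlmostFixed f (G.connectedComponentMk x) → h x ∉ t) ∧
      q = t.image fun x => (x, h x)} ?_ ?_
  · rintro _ ⟨h, t, hh, hfix, hmove, rfl⟩ g ⟨hg, hS⟩ s
    obtain ⟨a, ha, hac, w, hw, hwt⟩ := cluster_dense_step hG hinf hf hg hS hh t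
      (S ∪ s ∪ s.image g) hfix hmove
    refine ⟨a⁻¹ * g * a, ⟨componentMates_conj hac hg, isOrbitReps_conj hS fun x hx => ha x ?_⟩,
      fun x hx => conj_apply_eq (ha x ?_) (ha _ ?_), w, hw, by simpa using hwt⟩
    · have : x ∈ S := hx
      simp only [Finset.mem_union]; tauto
    · simp only [Finset.mem_union]; tauto
    · have := Finset.mem_image_of_mem g hx
      simp only [Finset.mem_union]; tauto
  · rintro g ⟨hg, -⟩ H
    refine mem_denseMates_iff.2 fun h => cluster_approximable hG hinf hf hg ?_ h
    intro h t hh hfix hmove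
    obtain ⟨w, hw, hwt⟩ := H _ ⟨h, t, hh, hfix, hmove, rfl⟩
    exact ⟨w, hw, by simpa using hwt⟩

end ClusterGeneration

theorem copiesKomega_comeagreIn {n : ℕ} (hn : 1 ≤ n) (f : copiesKomega n ≃g copiesKomega n)
    (hf : ∀ Γ : Set (Fin n × ℕ), Γ.Finite → Γ.Nonempty → f '' Γ = Γ →
      ∃ L L' : (copiesKomega n).ConnectedComponent,
        (L.supp ∩ Γ).ncard ≠ (L'.supp ∩ Γ).ncard) (S : Finset (Fin n × ℕ)) :
    ComeagreIn (denseMates f ∩ componentMatesReps f (S : Set (Fin n × ℕ)))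
      (componentMatesReps f (S : Set (Fin n × ℕ))) := by
  have : Nonempty (Fin n × ℕ) := ⟨⟨⟨0, hn⟩, 0⟩⟩
  have : Finite (copiesKomega n).ConnectedComponent := by
    refine Finite.of_surjective
      (fun i : Fin n => (copiesKomega n).connectedComponentMk (i, 0)) fun c => ?_
    induction c using SimpleGraph.ConnectedComponent.ind with | _ x
    exact ⟨x.1, (disjointCliques_mk_eq_iff _ _).2 rfl⟩
  refine cluster_comeagreIn disjointCliques_adj_iff (fun L => ?_) f hf S
  induction L using SimpleGraph.ConnectedComponent.ind with | _ x
  refine (Set.infinite_range_of_injective (f := fun k : ℕ => (x.1, k))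
    fun i j h => (Prod.ext_iff.1 h).2).mono ?_
  rintro _ ⟨k, rfl⟩
  exact (disjointCliques_mk_eq_iff _ _).2 rfl

/-! ### Cycle-free finite partial isomorphisms of H(n) -/

section RankedPartialIso

variable {V : Type*} [DecidableEq V] {H : SimpleGraph V}

/-- The domain of a finite relation. -/
def relDom (p : Finset (V × V)) : Finset V := p.image Prod.fst

/-- The range of a finite relation. -/
def relRan (p : Finset (V × V)) : Finset V := p.image Prod.snd

theorem mem_relDom {p : Finset (V × V)} {x : V} : x ∈ relDom p ↔ ∃ y, (x, y) ∈ p := by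
  simp [relDom]

theorem mem_relRan {p : Finset (V × V)} {y : V} : y ∈ relRan p ↔ ∃ x, (x, y) ∈ p := by
  simp [relRan]

theorem relDom_insert (p : Finset (V × V)) (x y : V) :
    relDom (insert (x, y) p) = insert x (relDom p) := by simp [relDom]

theorem relRan_insert (p : Finset (V × V)) (x y : V) :
    relRan (insert (x, y) p) = insert y (relRan p) := by simp [relRan]

/-- A finite partial isomorphism together with a function increasing by one along it, which
witnesses that it has no cycles. -/
structure IsRankedPartialIso (H : SimpleGraph V) (p : Finset (V × V)) (ρ : V → ℤ) : Prop where
  inj : ∀ a ∈ p, ∀ b ∈ p, a.1 = b.1 ↔ a.2 = b.2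
  adj : ∀ a ∈ p, ∀ b ∈ p, H.Adj a.1 b.1 ↔ H.Adj a.2 b.2
  rank : ∀ a ∈ p, ρ a.2 = ρ a.1 + 1

theorem mem_image_swap {p : Finset (V × V)} {x y : V} :
    (x, y) ∈ p.image Prod.swap ↔ (y, x) ∈ p := by
  simp

theorem relDom_image_swap (p : Finset (V × V)) : relDom (p.image Prod.swap) = relRan p := by
  ext; simp [mem_relDom, mem_relRan]

theorem relRan_image_swap (p : Finset (V × V)) : relRan (p.image Prod.swap) = relDom p := by
  ext; simp [mem_relDom, mem_relRan]

theorem IsRankedPartialIso.swap {p : Finset (V × V)} {ρ : V → ℤ} (h : IsRankedPartialIso H p ρ) :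
    IsRankedPartialIso H (p.image Prod.swap) fun x => -ρ x where
  inj := by
    simp only [Finset.mem_image]
    rintro _ ⟨a, ha, rfl⟩ _ ⟨b, hb, rfl⟩
    exact (h.inj a ha b hb).symm
  adj := by
    simp only [Finset.mem_image]
    rintro _ ⟨a, ha, rfl⟩ _ ⟨b, hb, rfl⟩
    exact (h.adj a ha b hb).symm
  rank := by
    simp only [Finset.mem_image]
    rintro _ ⟨a, ha, rfl⟩
    have := h.rank a ha
    simp only [Prod.fst_swap, Prod.snd_swap]
    omega

/-- The points forced to be adjacent to any image of `x` under an extension of `p`. -/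
def forcedNeighbours (H : SimpleGraph V) [DecidableRel H.Adj] (p : Finset (V × V)) (x : V) :
    Finset V := (p.filter fun a => H.Adj a.1 x).image Prod.snd

theorem mem_forcedNeighbours [DecidableRel H.Adj] {p : Finset (V × V)} {x c : V} :
    c ∈ forcedNeighbours H p x ↔ ∃ d, (d, c) ∈ p ∧ H.Adj d x := by
  simp [forcedNeighbours]

/-- A forbidden clique pulls back through `p` to one whose vertices are all adjacent to `x`, giving
a K_n. -/
theorem cliqueFreeOn_forcedNeighbours [DecidableRel H.Adj] {n : ℕ} (hn : 1 ≤ n)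
    (hH : H.CliqueFree n) {p : Finset (V × V)} {ρ : V → ℤ} (hp : IsRankedPartialIso H p ρ) (x : V) :
    H.CliqueFreeOn (forcedNeighbours H p x : Set V) (n - 1) := by
  intro t ht htc
  have hch : ∀ c, ∃ d, c ∈ t → (d, c) ∈ p ∧ H.Adj d x := fun c => by
    by_cases hc : c ∈ t
    · obtain ⟨d, hd⟩ := mem_forcedNeighbours.1 (ht hc)
      exact ⟨d, fun _ => hd⟩
    · exact ⟨c, fun h => absurd h hc⟩
  choose s hs using hch
  have hcl : H.IsNClique (n - 1) (t.image s) := by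
    rw [SimpleGraph.isNClique_iff] at htc ⊢
    constructor
    · intro a ha b hb hab
      obtain ⟨c, hc, rfl⟩ := Finset.mem_image.1 (Finset.mem_coe.1 ha)
      obtain ⟨d, hd, rfl⟩ := Finset.mem_image.1 (Finset.mem_coe.1 hb)
      refine (hp.adj _ (hs c hc).1 _ (hs d hd).1).2 (htc.1 hc hd ?_)
      rintro rfl
      exact hab rfl
    · rw [Finset.card_image_of_injOn, htc.2]
      intro c hc d hd hcd
      exact (hp.inj _ (hs c hc).1 _ (hs d hd).1).1 hcd
  have := hcl.insert (a := x) fun b hb => by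
    obtain ⟨c, hc, rfl⟩ := Finset.mem_image.1 hb
    exact (hs c hc).2.symm
  rw [Nat.sub_add_cancel hn] at this
  exact hH _ this

/-- A point with prescribed neighbours in a finite set, moved by `f`. -/
theorem exists_moved_point {n : ℕ} (hn : 3 ≤ n) (hH : IsUniversalCliqueFree n H) {f : H ≃g H}
    (hf : (autSupport f).Infinite) {A F : Finset V} (hAF : A ⊆ F)
    (hA : H.CliqueFreeOn (A : Set V) (n - 1)) :
    ∃ y, y ∉ F ∧ f y ≠ y ∧ ∀ c ∈ F, H.Adj y c ↔ c ∈ A := by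
  obtain ⟨v, hv, hvF⟩ := hf.exists_notMem_finset F
  have hv' : f v ≠ v := hv
  -- Adjacent to `v` but not to `f v`, the vertex `u` is moved by `f`. It has no neighbours in `F`,
  -- so adding it to `A` creates no K_{n-1}; the same trick with `u` in place of `v` then makes `y`
  -- moved.
  obtain ⟨u, huv, huB, hua, hub⟩ := hH.restaurant {v}
    ((F ∪ {f v} ∪ F.image f.symm).erase v) (by simp) (by
      intro t ht htc
      have h1 := Finset.card_le_card (Finset.coe_subset.1 ht)
      rw [htc.card_eq, Finset.card_singleton] at h1
      omega)
  simp only [Finset.mem_singleton, forall_eq] at huv hua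
  have huF : u ∉ F := fun h => huB (by simp [h, huv])
  have hfuF : f u ∉ F := fun h => huB (by
    refine Finset.mem_erase.2 ⟨huv, Finset.mem_union_right _ (Finset.mem_image.2 ⟨_, h, ?_⟩)⟩
    simp)
  have huadj : ∀ c ∈ F, ¬ H.Adj u c := fun c hc => hub c (by
    refine Finset.mem_erase.2 ⟨fun h => hvF (h ▸ hc), by simp [hc]⟩)
  have hfu : f u ≠ u := fun h => hub (f v) (by simp [hv']) (by
    have := f.map_adj_iff.2 hua
    rwa [h] at this)
  obtain ⟨y, hyA, hyB, hya, hyb⟩ := hH.restaurant (insert u A) ((F ∪ {f u}) \ insert u A)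
    Finset.disjoint_sdiff (by
      intro t ht htc
      by_cases hut : u ∈ t
      · obtain ⟨b, hb, hbu⟩ := Finset.exists_mem_ne (by rw [htc.card_eq]; omega) u
        have hbA : b ∈ A := by
          have := ht hb
          simp only [Finset.coe_insert, mem_insert_iff, hbu, false_or] at this
          exact this
        exact huadj b (hAF hbA) (htc.isClique hut hb hbu.symm)
      · refine hA (fun b hb => ?_) htc
        have := ht hb
        simp only [Finset.coe_insert, mem_insert_iff] at this
        exact this.resolve_left fun e => hut (e ▸ hb))
  have hFsub : ∀ c ∈ F, c ∉ A → c ∈ (F ∪ {f u}) \ insert u A := fun c hc hcA => by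
    have : c ≠ u := fun e => huF (e ▸ hc)
    simp [hc, hcA, this]
  refine ⟨y, fun hy => ?_, fun hy => ?_, fun c hc => ⟨fun h => ?_, fun h => hya c (by simp [h])⟩⟩
  · exact hyB (hFsub y hy fun h => hyA (by simp [h]))
  · refine hyb (f u) ?_ ?_
    · simpa [hfu] using fun h => hfuF (hAF h)
    · have := f.map_adj_iff.2 (hya u (by simp))
      rwa [hy] at this
  · by_contra hcA
    exact hyb c (hFsub c hc hcA) h

/-- The forced neighbours span no K_{n-1}, so some new `y` has exactly these neighbours in `F`.
Being new, it can be ranked one above `x` without closing a cycle. -/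
theorem IsRankedPartialIso.exists_free_extension {n : ℕ} (hn : 3 ≤ n)
    (hH : IsUniversalCliqueFree n H) {f : H ≃g H} (hf : (autSupport f).Infinite)
    {p : Finset (V × V)} {ρ : V → ℤ} (hp : IsRankedPartialIso H p ρ) {x : V} (hx : x ∉ relDom p)
    {F : Finset V} (hdF : relDom p ⊆ F) (hrF : relRan p ⊆ F) (hxF : x ∈ F) :
    ∃ y, y ∉ F ∧ f y ≠ y ∧ (∀ c ∈ F, H.Adj y c → ∃ d, (d, c) ∈ p ∧ H.Adj d x) ∧
      IsRankedPartialIso H (insert (x, y) p) (Function.update ρ y (ρ x + 1)) := by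
  classical
  obtain ⟨y, hyF, hfy, hy⟩ := exists_moved_point hn hH hf (A := forcedNeighbours H p x) (F := F)
    (fun c hc => hrF (mem_relRan.2 (by
      obtain ⟨d, hd, -⟩ := mem_forcedNeighbours.1 hc
      exact ⟨d, hd⟩))) (cliqueFreeOn_forcedNeighbours (by omega) hH.cliqueFree hp x)
  simp only [mem_forcedNeighbours] at hy
  have hd : ∀ a ∈ p, a.1 ∈ F ∧ a.1 ≠ x := fun a ha =>
    have : a.1 ∈ relDom p := mem_relDom.2 ⟨a.2, ha⟩
    ⟨hdF this, fun e => hx (e ▸ this)⟩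
  have hr : ∀ a ∈ p, a.2 ∈ F := fun a ha => hrF (mem_relRan.2 ⟨a.1, ha⟩)
  have hadj : ∀ a ∈ p, H.Adj y a.2 ↔ H.Adj x a.1 := fun a ha => by
    rw [hy _ (hr a ha)]
    constructor
    · rintro ⟨d, hdp, hdx⟩
      rw [← (hp.inj _ hdp a ha).2 rfl]
      exact hdx.symm
    · exact fun h => ⟨a.1, ha, h.symm⟩
  have hne : ∀ {v}, v ∈ F → v ≠ y := fun hv e => hyF (e ▸ hv)
  refine ⟨y, hyF, hfy, fun c hc => (hy c hc).1, ?_, ?_, ?_⟩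
  · intro a ha b hb
    rcases Finset.mem_insert.1 ha with rfl | ha <;> rcases Finset.mem_insert.1 hb with rfl | hb
    · simp
    · exact ⟨fun e => absurd e.symm (hd b hb).2, fun e => absurd e.symm (hne (hr b hb))⟩
    · exact ⟨fun e => absurd e (hd a ha).2, fun e => absurd e (hne (hr a ha))⟩
    · exact hp.inj a ha b hb
  · intro a ha b hb
    rcases Finset.mem_insert.1 ha with rfl | ha <;> rcases Finset.mem_insert.1 hb with rfl | hb
    · simp
    · exact (hadj b hb).symm
    · rw [H.adj_comm, H.adj_comm a.2]
      exact (hadj a ha).symm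
    · exact hp.adj a ha b hb
  · intro a ha
    rcases Finset.mem_insert.1 ha with rfl | ha
    · simp [Function.update_of_ne (hne hxF)]
    · rw [Function.update_of_ne (hne (hr a ha)), Function.update_of_ne (hne (hd a ha).1)]
      exact hp.rank a ha

/-- The rank of a point is its exponent relative to a chosen point of its orbit, unique because the
orbit is infinite. -/
theorem exists_isRankedPartialIso {g : H ≃g H} (hg : g ∈ noFiniteOrbits H) (s : Finset V) :
    ∃ ρ, IsRankedPartialIso H (s.image fun x => (x, g x)) ρ := by
  let S : Setoid V :=
    { r := fun x y => ∃ k : ℤ, (g ^ k) x = y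
      iseqv :=
        { refl := fun x => ⟨0, rfl⟩
          symm := by
            rintro x _ ⟨k, rfl⟩
            exact ⟨-k, by rw [← RelIso.mul_apply, ← zpow_add, neg_add_cancel]; rfl⟩
          trans := by
            rintro x _ _ ⟨k, rfl⟩ ⟨l, rfl⟩
            exact ⟨l + k, by rw [zpow_add, RelIso.mul_apply]⟩ } }
  have hout : ∀ x, ∃ k : ℤ, (g ^ k) (Quotient.mk S x).out = x := fun x => Quotient.mk_out x
  choose ρ hρ using hout
  refine ⟨ρ, ?_, ?_, ?_⟩
  · simp only [Finset.mem_image]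
    rintro _ ⟨x, -, rfl⟩ _ ⟨y, -, rfl⟩
    exact g.injective.eq_iff.symm
  · simp only [Finset.mem_image]
    rintro _ ⟨x, -, rfl⟩ _ ⟨y, -, rfl⟩
    exact g.map_adj_iff.symm
  · simp only [Finset.mem_image]
    rintro _ ⟨x, -, rfl⟩
    have hq : Quotient.mk S (g x) = Quotient.mk S x :=
      Quotient.sound (S.symm ⟨1, by rw [zpow_one]⟩)
    refine zpow_apply_injective (hg (Quotient.mk S x).out) ?_
    change (g ^ ρ (g x)) _ = (g ^ (ρ x + 1)) _
    rw [add_comm, zpow_add, zpow_one, RelIso.mul_apply, hρ, ← hq, hρ]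

/-- Every finite partial isomorphism without cycles extends to an automorphism without finite
orbits. -/
theorem IsRankedPartialIso.exists_extension {n : ℕ} (hn : 3 ≤ n)
    (hH : IsUniversalCliqueFree n H) {f : H ≃g H} (hf : (autSupport f).Infinite)
    {p : Finset (V × V)} {ρ : V → ℤ} (hp : IsRankedPartialIso H p ρ) :
    ∃ g ∈ noFiniteOrbits H, ∀ a ∈ p, g a.1 = a.2 := by
  have := hH.countable
  have := Encodable.ofCountable V
  have extend : ∀ (q : {q : Finset (V × V) // ∃ ρ, IsRankedPartialIso H q ρ}) (x : V),
      ∃ r : {q : Finset (V × V) // ∃ ρ, IsRankedPartialIso H q ρ}, q ≤ r ∧ x ∈ relDom r.1 := by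
    rintro ⟨q, σ, hq⟩ x
    by_cases hx : x ∈ relDom q
    · exact ⟨⟨q, σ, hq⟩, le_rfl, hx⟩
    · obtain ⟨y, -, -, -, hy⟩ := hq.exists_free_extension hn hH hf hx
        (F := relDom q ∪ relRan q ∪ {x}) (by intro; simp +contextual) (by intro; simp +contextual)
        (by simp)
      exact ⟨⟨_, _, hy⟩, Finset.subset_insert _ _, by simp [relDom_insert]⟩
  have extend' : ∀ (q : {q : Finset (V × V) // ∃ ρ, IsRankedPartialIso H q ρ}) (x : V),
      ∃ r : {q : Finset (V × V) // ∃ ρ, IsRankedPartialIso H q ρ}, q ≤ r ∧ x ∈ relRan r.1 := by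
    rintro ⟨q, σ, hq⟩ x
    obtain ⟨⟨r, τ, hr⟩, hqr, hx⟩ := extend ⟨q.image Prod.swap, _, hq.swap⟩ x
    refine ⟨⟨r.image Prod.swap, _, hr.swap⟩, fun a ha => ?_, by rwa [relRan_image_swap]⟩
    exact mem_image_swap.2 (hqr (mem_image_swap.2 ha))
  let D : V ⊕ V → Order.Cofinal {q : Finset (V × V) // ∃ ρ, IsRankedPartialIso H q ρ} := fun x =>
    Sum.elim (fun x => ⟨{q | x ∈ relDom q.1}, fun q => by
      obtain ⟨r, hr, hx⟩ := extend q x; exact ⟨r, hx, hr⟩⟩)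
      (fun x => ⟨{q | x ∈ relRan q.1}, fun q => by
      obtain ⟨r, hr, hx⟩ := extend' q x; exact ⟨r, hx, hr⟩⟩) x
  -- Back and forth, as a generic ideal of cycle-free partial isomorphisms.
  let I := Order.idealOfCofinals ⟨p, ρ, hp⟩ D
  have hpI : (⟨p, ρ, hp⟩ : {q : Finset (V × V) // ∃ ρ, IsRankedPartialIso H q ρ}) ∈ I :=
    Order.mem_idealOfCofinals _ _
  have htot : ∀ x, ∃ y, ∃ q ∈ I, (x, y) ∈ q.1 := fun x => by
    obtain ⟨q, hx, hq⟩ := Order.cofinal_meets_idealOfCofinals ⟨p, ρ, hp⟩ D (Sum.inl x)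
    obtain ⟨y, hy⟩ := mem_relDom.1 (show x ∈ relDom q.1 from hx)
    exact ⟨y, q, hq, hy⟩
  have hsurj : ∀ y, ∃ x, ∃ q ∈ I, (x, y) ∈ q.1 := fun y => by
    obtain ⟨q, hx, hq⟩ := Order.cofinal_meets_idealOfCofinals ⟨p, ρ, hp⟩ D (Sum.inr y)
    obtain ⟨x, hx⟩ := mem_relRan.1 (show y ∈ relRan q.1 from hx)
    exact ⟨x, q, hq, hx⟩
  have hdir : ∀ q ∈ I, ∀ r ∈ I, ∃ s ∈ I, q ≤ s ∧ r ≤ s := I.directed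
  choose F hF using htot
  choose F' hF' using hsurj
  have hFinj : ∀ x y, ∀ q ∈ I, (x, y) ∈ q.1 → F x = y ∧ F' y = x := by
    intro x y q hq hxy
    obtain ⟨r, hr, hxr⟩ := hF x
    obtain ⟨r', hr', hyr⟩ := hF' y
    obtain ⟨s, hs, hqs, hrs⟩ := hdir q hq r hr
    obtain ⟨u, hu, hsu, hr'u⟩ := hdir s hs r' hr'
    obtain ⟨_, hσ⟩ := u.2
    exact ⟨(hσ.inj _ (hsu (hrs hxr)) _ (hsu (hqs hxy))).1 rfl,
      (hσ.inj _ (hr'u hyr) _ (hsu (hqs hxy))).2 rfl⟩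
  let g : H ≃g H :=
    { toFun := F
      invFun := F'
      left_inv := fun x => by
        obtain ⟨q, hq, hx⟩ := hF x
        exact (hFinj _ _ q hq hx).2
      right_inv := fun y => by
        obtain ⟨q, hq, hy⟩ := hF' y
        exact (hFinj _ _ q hq hy).1
      map_rel_iff' := by
        intro x y
        obtain ⟨q, hq, hx⟩ := hF x
        obtain ⟨r, hr, hy⟩ := hF y
        obtain ⟨s, hs, hqs, hrs⟩ := hdir q hq r hr
        obtain ⟨_, hσ⟩ := s.2
        exact (hσ.adj _ (hqs hx) _ (hrs hy)).symm }
  have hgF : ∀ x, g x = F x := fun _ => rfl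
  refine ⟨g, fun x hfin => ?_, fun a ha => (hFinj a.1 a.2 _ hpI ha).1⟩
  -- Ranks of different stages need not agree, but any repetition in the orbit already occurs in one
  -- finite stage, whose rank excludes it.
  have hchain : ∀ m : ℕ, ∃ q ∈ I, ∀ i < m, ((g ^ i) x, (g ^ (i + 1)) x) ∈ q.1 := by
    intro m
    induction m with
    | zero => exact ⟨_, hpI, by simp⟩
    | succ m ih =>
      obtain ⟨q, hq, hqm⟩ := ih
      obtain ⟨r, hr, hx⟩ := hF ((g ^ m) x)
      obtain ⟨s, hs, hqs, hrs⟩ := hdir q hq r hr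
      refine ⟨s, hs, fun i hi => ?_⟩
      rcases Nat.lt_succ_iff_lt_or_eq.1 hi with hi | rfl
      · exact hqs (hqm i hi)
      · rw [pow_succ', RelIso.mul_apply, hgF]
        exact hrs hx
  have hninj : ¬ Function.Injective fun i : ℕ => (g ^ i) x := fun hinj =>
    Set.infinite_range_of_injective hinj (hfin.subset (by
      rintro _ ⟨i, rfl⟩
      exact ⟨i, by simp⟩))
  simp only [Function.Injective, not_forall] at hninj
  obtain ⟨i, j, hij, hne⟩ := hninj
  obtain ⟨q, -, hq⟩ := hchain (i + j)
  obtain ⟨σ, hσ⟩ := q.2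
  have hrank : ∀ k ≤ i + j, σ ((g ^ k) x) = σ x + k := by
    intro k hk
    induction k with
    | zero => simp
    | succ k ih =>
      have := hσ.rank _ (hq k (by omega))
      simp only at this
      rw [this, ih (by omega)]
      push_cast; ring
  have h1 := hrank i (by omega)
  have h2 := hrank j (by omega)
  rw [hij, h2] at h1
  exact hne (by omega)

end RankedPartialIso

/-! ### Moving tuples of H(n) to unconstrained positions -/

section Neutral

variable {V : Type*} {H : SimpleGraph V}

/-- Every automorphism extending `p` generates, together with `f`, an element agreeing with `τ`
on `t`. -/
def Connects (f : H ≃g H) (p : Finset (V × V)) (t : Finset V) (τ : V → V) : Prop :=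
  ∀ g : H ≃g H, (∀ a ∈ p, g a.1 = a.2) → ∃ w ∈ Subgroup.closure {f, g}, ∀ x ∈ t, w x = τ x

theorem Connects.mono {f : H ≃g H} {p q : Finset (V × V)} {t : Finset V} {τ : V → V}
    (h : Connects f p t τ) (hpq : p ⊆ q) : Connects f q t τ :=
  fun g hg => h g fun a ha => hg a (hpq ha)

variable [DecidableEq V]

theorem Connects.comp {f : H ≃g H} {p : Finset (V × V)} {t : Finset V} {τ σ : V → V}
    (h : Connects f p t τ) (h' : Connects f p (t.image τ) σ) : Connects f p t (σ ∘ τ) := by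
  intro g hg
  obtain ⟨w, hw, hwt⟩ := h g hg
  obtain ⟨v, hv, hvt⟩ := h' g hg
  refine ⟨v * w, mul_mem hv hw, fun x hx => ?_⟩
  rw [RelIso.mul_apply, hwt x hx, hvt _ (Finset.mem_image_of_mem _ hx)]
  rfl

/-- `p` arises from `p₀` by successively adding images that are generic over the finite set `O`
and its images under `f` and `f⁻¹`. -/
structure IsGenericExtension (f : H ≃g H) (p₀ : Finset (V × V)) (ρ₀ : V → ℤ) (E O : Finset V)
    (C : ℤ) (p : Finset (V × V)) (ρ : V → ℤ) : Prop where
  ranked : IsRankedPartialIso H p ρ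
  le : p₀ ⊆ p
  new : ∀ a ∈ p, a ∈ p₀ ∨ a.2 ∉ O ∧ f a.2 ∉ O ∧ f.symm a.2 ∉ O
  dom : ∀ a ∈ p, a.1 ∈ E ∪ relRan p
  near : ∀ y ∈ relRan p, y ∉ O → ∀ c, c ∈ O ∨ f c ∈ O ∨ f.symm c ∈ O → H.Adj y c →
    c ∈ relRan p₀ ∧ ρ y ≤ ρ c + C
  image : ∀ y ∈ relRan p, y ∉ O → f y ∉ relRan p
  sparse : ∀ y ∈ relRan p, y ∉ O → ∀ d ∈ relRan p, d ∉ O → d ≠ y → ¬ H.Adj (f y) d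
  rank_eq : ∀ x ∈ O, ρ x = ρ₀ x

variable {n : ℕ} {f : H ≃g H} {p₀ : Finset (V × V)} {ρ₀ : V → ℤ} {E O : Finset V} {C : ℤ}

theorem IsGenericExtension.mem_of_mem_ran {p : Finset (V × V)} {ρ : V → ℤ}
    (h : IsGenericExtension f p₀ ρ₀ E O C p ρ) {c : V} (hc : c ∈ relRan p)
    (hcO : c ∈ O ∨ f c ∈ O ∨ f.symm c ∈ O) : c ∈ relRan p₀ := by
  obtain ⟨d, hd⟩ := mem_relRan.1 hc
  rcases h.new _ hd with h' | ⟨h1, h2, h3⟩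
  · exact mem_relRan.2 ⟨d, h'⟩
  · simp only at h1 h2 h3
    tauto

/-- A neighbour `c` in the range of the new image of `x` comes from a neighbour of `x` one rank
below `c`, so the rank bound in `near` is inherited. The remaining clauses follow from freeness of
the new point. -/
theorem IsGenericExtension.insert (hn : 3 ≤ n) (hH : IsUniversalCliqueFree n H)
    (hf : (autSupport f).Infinite) (hEO : E ⊆ O) (hd₀ : relDom p₀ ⊆ O) (hr₀ : relRan p₀ ⊆ O)
    (hC : ∀ x ∈ O, ∀ y ∈ O, ρ₀ x ≤ ρ₀ y + C) {p : Finset (V × V)} {ρ : V → ℤ}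
    (h : IsGenericExtension f p₀ ρ₀ E O C p ρ) {x : V} (hx : x ∈ E ∪ relRan p)
    (hxd : x ∉ relDom p) :
    ∃ y ρ', y ∉ O ∪ relRan p ∧ (∀ v ∈ O ∪ relRan p, ρ' v = ρ v) ∧
      IsGenericExtension f p₀ ρ₀ E O C (insert (x, y) p) ρ' := by
  set B := O ∪ relRan p
  -- Including the images under `f` and f⁻¹ also controls adjacencies of `f y` with `B`.
  set F := B ∪ B.image f ∪ B.image f.symm
  have hBF : B ⊆ F := fun _ hv => by simp [F, hv]
  have hdomB : relDom p ⊆ B := fun v hv => by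
    obtain ⟨w, hw⟩ := mem_relDom.1 hv
    rcases Finset.mem_union.1 (h.dom _ hw) with h1 | h1
    · exact Finset.mem_union_left _ (hEO h1)
    · exact Finset.mem_union_right _ h1
  have hxB : x ∈ B := by
    rcases Finset.mem_union.1 hx with h1 | h1
    · exact Finset.mem_union_left _ (hEO h1)
    · exact Finset.mem_union_right _ h1
  have hrB : relRan p ⊆ B := Finset.subset_union_right
  have hOB : O ⊆ B := Finset.subset_union_left
  obtain ⟨y, hyF, hfy, hyadj, hrk⟩ := h.ranked.exists_free_extension hn hH hf hxd
    (hdomB.trans hBF) (hrB.trans hBF) (hBF hxB)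
  have hyB : y ∉ B := fun h' => hyF (hBF h')
  have hfyB : f y ∉ B := fun h' => hyF (by
    refine Finset.mem_union_right _ (Finset.mem_image.2 ⟨_, h', by simp⟩))
  have hsyB : f.symm y ∉ B := fun h' => hyF (by
    refine Finset.mem_union_left _ (Finset.mem_union_right _ (Finset.mem_image.2 ⟨_, h', by simp⟩)))
  have hfF : ∀ v ∈ B, f v ∈ F := fun v hv => by
    exact Finset.mem_union_left _ (Finset.mem_union_right _ (Finset.mem_image_of_mem _ hv))
  have hsF : ∀ v ∈ B, f.symm v ∈ F := fun v hv => by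
    exact Finset.mem_union_right _ (Finset.mem_image_of_mem _ hv)
  have hforced : ∀ c ∈ F, H.Adj y c → c ∈ relRan p := fun c hc hyc => by
    obtain ⟨d, hd, -⟩ := hyadj c hc hyc
    exact mem_relRan.2 ⟨d, hd⟩
  have hup : ∀ v ∈ B, Function.update ρ y (ρ x + 1) v = ρ v := fun v hv =>
    Function.update_of_ne (ne_of_mem_of_not_mem hv hyB) _ _
  have hyO : y ∉ O := fun h' => hyB (hOB h')
  refine ⟨y, Function.update ρ y (ρ x + 1), hyB, hup, hrk, h.le.trans (Finset.subset_insert _ _),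
    ?_, ?_, ?_, ?_, ?_, fun v hv => (hup v (hOB hv)).trans (h.rank_eq v hv)⟩
  · intro a ha
    rcases Finset.mem_insert.1 ha with rfl | ha
    · exact Or.inr ⟨hyO, fun h' => hfyB (hOB h'), fun h' => hsyB (hOB h')⟩
    · exact h.new a ha
  · intro a ha
    rw [relRan_insert]
    rcases Finset.mem_insert.1 ha with rfl | ha
    · simp only [Finset.mem_union, Finset.mem_insert] at hx ⊢; tauto
    · have := h.dom a ha
      simp only [Finset.mem_union, Finset.mem_insert] at this ⊢; tauto
  · intro u hu huO c hc huc
    rw [relRan_insert] at hu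
    have hcF : c ∈ F := by
      rcases hc with hc | hc | hc
      · exact hBF (hOB hc)
      · simpa using hsF _ (hOB hc)
      · simpa using hfF _ (hOB hc)
    rcases Finset.mem_insert.1 hu with rfl | hu
    · obtain ⟨d, hd, hdx⟩ := hyadj c hcF huc
      have hcr : c ∈ relRan p := mem_relRan.2 ⟨d, hd⟩
      have hc₀ := h.mem_of_mem_ran hcr hc
      have hdp : (d, c) ∈ p₀ := by
        rcases h.new _ hd with h' | ⟨h1, -, -⟩
        · exact h'
        · exact absurd (hr₀ hc₀) h1
      have hdO : d ∈ O := hd₀ (mem_relDom.2 ⟨c, hdp⟩)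
      refine ⟨hc₀, ?_⟩
      rw [hup c (hrB hcr), Function.update_self]
      have hrd := h.ranked.rank _ hd
      simp only at hrd
      have hxd' : ρ x ≤ ρ d + C := by
        by_cases hxO : x ∈ O
        · rw [h.rank_eq x hxO, h.rank_eq d hdO]
          exact hC x hxO d hdO
        · refine (h.near x ?_ hxO d (Or.inl hdO) hdx.symm).2
          rcases Finset.mem_union.1 hx with h1 | h1
          · exact absurd (hEO h1) hxO
          · exact h1
      omega
    · have := h.near u hu huO c hc huc
      refine ⟨this.1, ?_⟩
      rw [hup u (hrB hu), hup c (hOB (hr₀ this.1))]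
      exact this.2
  · intro u hu huO
    rw [relRan_insert] at hu ⊢
    rcases Finset.mem_insert.1 hu with rfl | hu
    · simp only [Finset.mem_insert, not_or]
      exact ⟨hfy, fun h' => hfyB (hrB h')⟩
    · simp only [Finset.mem_insert, not_or]
      refine ⟨fun e => hsyB ?_, h.image u hu huO⟩
      rw [← e]; simpa using hrB hu
  · intro u hu huO d hd hdO hdu
    rw [relRan_insert] at hu hd
    rcases Finset.mem_insert.1 hu with rfl | hu' <;> rcases Finset.mem_insert.1 hd with rfl | hd'
    · exact absurd rfl hdu
    · intro hadj
      have h1 : H.Adj u (f.symm d) := by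
        rw [← f.map_adj_iff]; simpa using hadj
      have h2 := hforced _ (hsF d (hrB hd')) h1
      -- If f⁻¹(d) is in `O`, then `d` is not generic; otherwise f⁻¹(d) and its `f`-image are both
      -- in the range, against `image`.
      by_cases h3 : f.symm d ∈ O
      · exact hdO (hr₀ (h.mem_of_mem_ran hd' (Or.inr (Or.inr h3))))
      · exact h.image _ h2 h3 (by simpa using hd')
    · intro hadj
      exact h.image u hu' huO (hforced _ (hfF u (hrB hu')) hadj.symm)
    · exact h.sparse u hu' huO d hd' hdO hdu

theorem IsGenericExtension.insert_finset (hn : 3 ≤ n) (hH : IsUniversalCliqueFree n H)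
    (hf : (autSupport f).Infinite) (hEO : E ⊆ O) (hd₀ : relDom p₀ ⊆ O) (hr₀ : relRan p₀ ⊆ O)
    (hC : ∀ x ∈ O, ∀ y ∈ O, ρ₀ x ≤ ρ₀ y + C) {p : Finset (V × V)} {ρ : V → ℤ}
    (h : IsGenericExtension f p₀ ρ₀ E O C p ρ) (T : Finset V) (hT : T ⊆ E ∪ relRan p) :
    ∃ q σ, p ⊆ q ∧ (∀ v ∈ O ∪ relRan p, σ v = ρ v) ∧ IsGenericExtension f p₀ ρ₀ E O C q σ ∧
      T ⊆ relDom q ∧ relDom q ⊆ relDom p ∪ T ∧ ∀ a ∈ q, a ∈ p ∨ a.2 ∉ O ∪ relRan p := by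
  induction T using Finset.induction_on with
  | empty => exact ⟨p, ρ, subset_rfl, fun _ _ => rfl, h, by simp, by simp, fun a ha => Or.inl ha⟩
  | insert x T hxT ih =>
    obtain ⟨q, σ, hpq, hσ, hq, hTq, hdq, hnew⟩ :=
      ih fun v hv => hT (Finset.mem_insert_of_mem hv)
    by_cases hx : x ∈ relDom q
    · refine ⟨q, σ, hpq, hσ, hq, Finset.insert_subset hx hTq, hdq.trans ?_, hnew⟩
      exact Finset.union_subset_union_right (Finset.subset_insert _ _)
    · have hran : O ∪ relRan p ⊆ O ∪ relRan q :=
        Finset.union_subset_union_right (Finset.image_subset_image hpq)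
      obtain ⟨y, σ', hy, hσ', hq'⟩ := hq.insert hn hH hf hEO hd₀ hr₀ hC (x := x) (by
        have := hT (Finset.mem_insert_self x T)
        exact Finset.union_subset_union_right (Finset.image_subset_image hpq) this) hx
      refine ⟨_, σ', hpq.trans (Finset.subset_insert _ _),
        fun v hv => (hσ' v (hran hv)).trans (hσ v hv), hq', ?_, ?_, ?_⟩
      · rw [relDom_insert]
        exact Finset.insert_subset_insert _ hTq
      · rw [relDom_insert]
        intro v hv
        rcases Finset.mem_insert.1 hv with rfl | hv
        · simp
        · have := hdq hv
          simp only [Finset.mem_union, Finset.mem_insert] at this ⊢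
          tauto
      · intro a ha
        rcases Finset.mem_insert.1 ha with rfl | ha
        · exact Or.inr fun h' => hy (hran h')
        · exact hnew a ha

theorem IsGenericExtension.exists_iterate (hn : 3 ≤ n) (hH : IsUniversalCliqueFree n H)
    (hf : (autSupport f).Infinite) (hEO : E ⊆ O) (hd₀ : relDom p₀ ⊆ E) (hr₀ : relRan p₀ ⊆ O)
    (hC : ∀ x ∈ O, ∀ y ∈ O, ρ₀ x ≤ ρ₀ y + C) (hp₀ : IsRankedPartialIso H p₀ ρ₀)
    {t : Finset V} (ht : t ⊆ E) (m : ℕ) :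
    ∃ p ρ τ, IsGenericExtension f p₀ ρ₀ E O C p ρ ∧ Connects f p t τ ∧
      (∀ x ∈ t, τ x ∈ E ∪ relRan p ∧ ρ (τ x) = ρ₀ x + m) ∧
      (Disjoint t (relDom p₀) → ∀ x ∈ t, τ x ∉ relDom p) := by
  have hd₀O := hd₀.trans hEO
  have hsub : ∀ p : Finset (V × V), E ∪ relRan p ⊆ O ∪ relRan p := fun p =>
    Finset.union_subset_union_left hEO
  induction m with
  | zero =>
    refine ⟨p₀, ρ₀, id, ⟨hp₀, subset_rfl, fun a ha => Or.inl ha, fun a ha => ?_,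
      fun y hy hyO => absurd (hr₀ hy) hyO, fun y hy hyO => absurd (hr₀ hy) hyO,
      fun y hy hyO => absurd (hr₀ hy) hyO, fun _ _ => rfl⟩, fun g _ => ⟨1, one_mem _,
      fun _ _ => rfl⟩, fun x hx => ⟨Finset.mem_union_left _ (ht hx), by simp⟩,
      fun hd x hx => Finset.disjoint_left.1 hd hx⟩
    exact Finset.mem_union_left _ (hd₀ (mem_relDom.2 ⟨a.2, ha⟩))
  | succ m ih =>
    obtain ⟨p, ρ, τ, hp, hcon, hτ, hdis⟩ := ih
    obtain ⟨q, σ, hpq, hσ, hq, hTq, hdq, hnew⟩ := hp.insert_finset hn hH hf hEO hd₀O hr₀ hC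
      (t.image τ) (by
        intro v hv
        obtain ⟨x, hx, rfl⟩ := Finset.mem_image.1 hv
        exact (hτ x hx).1)
    have hch : ∀ v, ∃ w, v ∈ relDom q → (v, w) ∈ q := fun v => by
      by_cases hv : v ∈ relDom q
      · obtain ⟨w, hw⟩ := mem_relDom.1 hv
        exact ⟨w, fun _ => hw⟩
      · exact ⟨v, fun h => absurd h hv⟩
    choose F hF using hch
    have hFq : ∀ x ∈ t, (τ x, F (τ x)) ∈ q := fun x hx =>
      hF _ (hTq (Finset.mem_image_of_mem _ hx))
    refine ⟨q, σ, F ∘ τ, hq, (hcon.mono hpq).comp fun g hg => ⟨g, Subgroup.subset_closure (by simp),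
      fun v hv => ?_⟩, fun x hx => ⟨Finset.mem_union_right _ (mem_relRan.2 ⟨_, hFq x hx⟩), ?_⟩,
      fun hd x hx hmem => ?_⟩
    · exact hg _ (hF v (hTq hv))
    · have h1 := hq.ranked.rank _ (hFq x hx)
      have h2 := hσ _ (hsub _ (hτ x hx).1)
      have h3 := (hτ x hx).2
      simp only [Function.comp_apply] at h1 ⊢
      push_cast
      omega
    -- Outside the domain, each point receives a new image, which avoids `O` and the old range and
    -- hence the enlarged domain.
    · have hnotp : (τ x, F (τ x)) ∉ p := fun h' => hdis hd x hx (mem_relDom.2 ⟨_, h'⟩)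
      have h1 := (hnew _ (hFq x hx)).resolve_left hnotp
      apply h1
      rcases Finset.mem_union.1 (hdq hmem) with h2 | h2
      · obtain ⟨w, hw⟩ := mem_relDom.1 h2
        exact hsub _ (hp.dom _ hw)
      · obtain ⟨x', hx', hxx⟩ := Finset.mem_image.1 h2
        simp only [Function.comp_apply] at hxx
        rw [← hxx]
        exact (Finset.union_subset_union_left hEO) (hτ x' hx').left

/-- Moving a finite set away from `O` by an element of `⟨f, g⟩`, leaving little adjacency. -/
theorem IsRankedPartialIso.exists_nearly_neutral (hn : 3 ≤ n) (hH : IsUniversalCliqueFree n H)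
    (hf : (autSupport f).Infinite) (hp₀ : IsRankedPartialIso H p₀ ρ₀) {t : Finset V} (ht : t ⊆ O)
    (hd₀ : relDom p₀ ⊆ O) (hr₀ : relRan p₀ ⊆ O) :
    ∃ p ρ z, IsRankedPartialIso H p ρ ∧ p₀ ⊆ p ∧ Connects f p t z ∧
      (∀ a ∈ p, a ∈ p₀ ∨ a.2 ∉ O ∧ ∀ c ∈ O, H.Adj a.2 c → c ∈ relRan p₀) ∧
      (∀ a ∈ p, a.1 ∈ relDom p₀ ∪ t ∪ relRan p) ∧
      (∀ x ∈ t, z x ∉ O ∪ relRan p ∧ ∀ c ∈ O, ¬ H.Adj (z x) c) ∧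
      (Disjoint t (relDom p₀) → ∀ x ∈ t, ∀ c ∈ relDom p, ¬ H.Adj (z x) c) := by
  obtain ⟨C, hC⟩ : ∃ C : ℕ, ∀ x ∈ O, |ρ₀ x| ≤ C := by
    refine ⟨∑ x ∈ O, (ρ₀ x).natAbs, fun x hx => ?_⟩
    rw [Int.abs_eq_natAbs]
    exact_mod_cast Finset.single_le_sum (f := fun x => (ρ₀ x).natAbs) (fun _ _ => Nat.zero_le _) hx
  have hEO : relDom p₀ ∪ t ⊆ O := Finset.union_subset hd₀ ht
  -- Ranks on `O` lie in [-C, C], so differ by at most 2C. A neighbour in `O` caps the rank of a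
  -- generic point at 3C, while 4C + 1 steps raise it to at least 3C + 1.
  obtain ⟨p, ρ, τ, hp, hcon, hτ, hdis⟩ := IsGenericExtension.exists_iterate (f := f) (C := 2 * C)
    hn hH hf hEO Finset.subset_union_left hr₀ (fun x hx y hy => by
      have h1 := abs_le.1 (hC x hx)
      have h2 := abs_le.1 (hC y hy)
      omega) hp₀ (t := t) Finset.subset_union_right (4 * C + 1)
  have hlarge : ∀ x ∈ t, ∀ c ∈ O, ρ c + 2 * C < ρ (τ x) := fun x hx c hc => by
    rw [(hτ x hx).2, hp.rank_eq c hc]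
    have h1 := abs_le.1 (hC x (ht hx))
    have h2 := abs_le.1 (hC c hc)
    push_cast
    omega
  have hτO : ∀ x ∈ t, τ x ∉ O := fun x hx h => by
    have := hlarge x hx _ h
    omega
  have hτr : ∀ x ∈ t, τ x ∈ relRan p := fun x hx =>
    (Finset.mem_union.1 (hτ x hx).1).resolve_left fun h => hτO x hx (hEO h)
  have hnadj : ∀ x ∈ t, ∀ c, c ∈ O ∨ f c ∈ O ∨ f.symm c ∈ O → ¬ H.Adj (τ x) c := by
    intro x hx c hc hadj
    obtain ⟨h1, h2⟩ := hp.near _ (hτr x hx) (hτO x hx) c hc hadj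
    have := hlarge x hx c (hr₀ h1)
    omega
  have hzO : ∀ x ∈ t, f (τ x) ∉ O := fun x hx h => hτO x hx
    (hr₀ (hp.mem_of_mem_ran (hτr x hx) (Or.inr (Or.inl h))))
  have hzadj : ∀ x ∈ t, ∀ c ∈ O, ¬ H.Adj (f (τ x)) c := fun x hx c hc hadj => by
    refine hnadj x hx (f.symm c) (Or.inr (Or.inl (by simpa using hc))) ?_
    rw [← f.map_adj_iff]; simpa using hadj
  have hzr : ∀ x ∈ t, ∀ c ∈ relRan p, H.Adj (f (τ x)) c → c = τ x := fun x hx c hc hadj => by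
    by_contra hne
    by_cases hcO : c ∈ O
    · exact hzadj x hx c hcO hadj
    · exact hp.sparse _ (hτr x hx) (hτO x hx) c hc hcO hne hadj
  -- A final application of `f` leaves the range of `p`; the only possible neighbour of f(τ x) there
  -- is τ x itself.
  refine ⟨p, ρ, f ∘ τ, hp.ranked, hp.le, hcon.comp fun g _ =>
    ⟨f, Subgroup.subset_closure (by simp), fun _ _ => rfl⟩, fun a ha => ?_, hp.dom,
    fun x hx => ⟨?_, hzadj x hx⟩, fun hd x hx c hc hadj => ?_⟩
  · refine (hp.new a ha).imp_right fun h => ⟨h.1, fun c hc hadj => ?_⟩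
    exact (hp.near _ (mem_relRan.2 ⟨a.1, ha⟩) h.1 c (Or.inl hc) hadj).1
  · rw [Finset.mem_union, not_or]
    exact ⟨hzO x hx, hp.image _ (hτr x hx) (hτO x hx)⟩
  · obtain ⟨w, hw⟩ := mem_relDom.1 hc
    rcases Finset.mem_union.1 (hp.dom _ hw) with h | h
    · exact hzadj x hx c (hEO h) hadj
    · have := hzr x hx c h hadj
      exact hdis hd x hx (this ▸ hc)

/-- Moving a finite set by an element of `⟨f, g⟩` to points without constraints on their images
under `g`. -/
theorem IsRankedPartialIso.exists_neutral (hn : 3 ≤ n) (hH : IsUniversalCliqueFree n H)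
    (hf : (autSupport f).Infinite) (hp₀ : IsRankedPartialIso H p₀ ρ₀) {t : Finset V} (ht : t ⊆ O)
    (hd₀ : relDom p₀ ⊆ O) (hr₀ : relRan p₀ ⊆ O) :
    ∃ p ρ z, IsRankedPartialIso H p ρ ∧ p₀ ⊆ p ∧ Connects f p t z ∧
      (∀ b ∈ relRan p, b ∈ relRan p₀ ∨ b ∉ O ∧ ∀ c ∈ O, H.Adj b c → c ∈ relRan p₀) ∧
      (∀ a ∈ relDom p, a ∈ relDom p₀ ∨ a ∈ t ∨ a ∈ relRan p₀ ∨
        a ∉ O ∧ ∀ c ∈ O, H.Adj a c → c ∈ relRan p₀) ∧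
      (∀ x ∈ t, z x ∉ O ∧ z x ∉ relDom p ∧ z x ∉ relRan p ∧ (∀ c ∈ O, ¬ H.Adj (z x) c) ∧
        ∀ c ∈ relDom p, ¬ H.Adj (z x) c) := by
  obtain ⟨p₁, ρ₁, z₁, hp₁, hle₁, hcon₁, hnew₁, hdom₁, hz₁, -⟩ :=
    hp₀.exists_nearly_neutral hn hH hf ht hd₀ hr₀
  set O₂ := O ∪ relRan p₁ ∪ t.image z₁
  have hOO : O ⊆ O₂ := fun v hv => by simp [O₂, hv]
  have hrO : relRan p₁ ⊆ O₂ := fun v hv => by simp [O₂, hv]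
  have hdor : relDom p₁ ⊆ O ∪ relRan p₁ := fun v hv => by
    obtain ⟨w, hw⟩ := mem_relDom.1 hv
    have := hdom₁ _ hw
    simp only [Finset.mem_union] at this ⊢
    rcases this with (h | h) | h
    · exact Or.inl (hd₀ h)
    · exact Or.inl (ht h)
    · exact Or.inr h
  have hdO : relDom p₁ ⊆ O₂ := hdor.trans Finset.subset_union_left
  -- The first round makes the tuple disjoint from the domain, which is what the second needs to
  -- exclude adjacency to the domain as well.
  obtain ⟨p₂, ρ₂, z₂, hp₂, hle₂, hcon₂, hnew₂, hdom₂, hz₂, hzd₂⟩ :=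
    hp₁.exists_nearly_neutral hn hH hf (t := t.image z₁) (O := O₂) Finset.subset_union_right hdO hrO
  have hran : ∀ b ∈ relRan p₂, b ∈ relRan p₀ ∨ b ∉ O ∧ ∀ c ∈ O, H.Adj b c → c ∈ relRan p₀ := by
    have h₁ : ∀ b ∈ relRan p₁,
        b ∈ relRan p₀ ∨ b ∉ O ∧ ∀ c ∈ O, H.Adj b c → c ∈ relRan p₀ := by
      intro b hb
      obtain ⟨a, ha⟩ := mem_relRan.1 hb
      exact (hnew₁ _ ha).imp_left fun h => mem_relRan.2 ⟨a, h⟩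
    intro b hb
    obtain ⟨a, ha⟩ := mem_relRan.1 hb
    rcases hnew₂ _ ha with h | ⟨h, h'⟩
    · exact h₁ b (mem_relRan.2 ⟨a, h⟩)
    · refine Or.inr ⟨fun hb => h (hOO hb), fun c hc hadj => ?_⟩
      exact (h₁ c (h' c (hOO hc) hadj)).resolve_right fun h => h.1 hc
  have hdisj : Disjoint (t.image z₁) (relDom p₁) := by
    refine Finset.disjoint_left.2 fun v hv hv' => ?_
    obtain ⟨x, hx, rfl⟩ := Finset.mem_image.1 hv
    exact (hz₁ x hx).1 (hdor hv')
  have hmem : ∀ x ∈ t, z₁ x ∈ t.image z₁ := fun x hx => Finset.mem_image_of_mem _ hx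
  have hranle : relRan p₁ ⊆ relRan p₂ := Finset.image_subset_image hle₂
  refine ⟨p₂, ρ₂, z₂ ∘ z₁, hp₂, hle₁.trans hle₂, (hcon₁.mono hle₂).comp hcon₂, hran, ?_, ?_⟩
  · have haux : ∀ a ∈ relRan p₂, a ∈ relDom p₀ ∨ a ∈ t ∨ a ∈ relRan p₀ ∨
        a ∉ O ∧ ∀ c ∈ O, H.Adj a c → c ∈ relRan p₀ := fun a ha => Or.inr (Or.inr (hran a ha))
    intro a ha
    obtain ⟨b, hb⟩ := mem_relDom.1 ha
    have := hdom₂ _ hb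
    simp only [Finset.mem_union] at this
    rcases this with (h | h) | h
    · obtain ⟨b, hb⟩ := mem_relDom.1 h
      have := hdom₁ _ hb
      simp only [Finset.mem_union] at this
      rcases this with (h | h) | h
      · exact Or.inl h
      · exact Or.inr (Or.inl h)
      · exact haux a (hranle h)
    · obtain ⟨x, hx, rfl⟩ := Finset.mem_image.1 h
      refine Or.inr (Or.inr (Or.inr ⟨fun h => (hz₁ x hx).1 (Finset.mem_union_left _ h), ?_⟩))
      exact fun c hc hadj => absurd hadj ((hz₁ x hx).2 c hc)
    · exact haux a h
  · intro x hx
    obtain ⟨h1, h2⟩ := hz₂ _ (hmem x hx)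
    rw [Finset.mem_union, not_or] at h1
    refine ⟨fun h => h1.1 (hOO h), fun h => ?_, h1.2, fun c hc => h2 c (hOO hc),
      hzd₂ hdisj _ (hmem x hx)⟩
    obtain ⟨w, hw⟩ := mem_relDom.1 h
    have := hdom₂ _ hw
    simp only [Finset.mem_union] at this
    rcases this with (h | h) | h
    · exact h1.1 (hdO h)
    · exact h1.1 (Finset.mem_union_right _ h)
    · exact h1.2 h

/-- Two isomorphic finite tuples of unconstrained new points can be matched. -/
theorem IsRankedPartialIso.union_image {p : Finset (V × V)} {ρ : V → ℤ}
    (hp : IsRankedPartialIso H p ρ) {t : Finset V} {z z' : V → V}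
    (hinj : ∀ x ∈ t, ∀ y ∈ t, z x = z y ↔ z' x = z' y)
    (hadj : ∀ x ∈ t, ∀ y ∈ t, H.Adj (z x) (z y) ↔ H.Adj (z' x) (z' y))
    (hne : ∀ x ∈ t, ∀ y ∈ t, z x ≠ z' y)
    (hz : ∀ x ∈ t, z x ∉ relDom p ∧ z x ∉ relRan p ∧ ∀ c ∈ relDom p, ¬ H.Adj (z x) c)
    (hz' : ∀ x ∈ t, z' x ∉ relDom p ∧ z' x ∉ relRan p ∧ ∀ c ∈ relRan p, ¬ H.Adj (z' x) c) :
    ∃ σ, IsRankedPartialIso H (p ∪ t.image fun x => (z x, z' x)) σ := by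
  have hd : ∀ a ∈ p, a.1 ∈ relDom p := fun a ha => mem_relDom.2 ⟨a.2, ha⟩
  have hr : ∀ a ∈ p, a.2 ∈ relRan p := fun a ha => mem_relRan.2 ⟨a.1, ha⟩
  -- The new pairs share no point with `p` and do not chain with each other, so their ranks may be
  -- reset.
  refine ⟨fun v => if v ∈ t.image z then 0 else if v ∈ t.image z' then 1 else ρ v, ?_, ?_, ?_⟩
  · intro a ha b hb
    simp only [Finset.mem_union, Finset.mem_image] at ha hb
    rcases ha with ha | ⟨x, hx, rfl⟩ <;> rcases hb with hb | ⟨y, hy, rfl⟩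
    · exact hp.inj a ha b hb
    · exact ⟨fun e => absurd e (ne_of_mem_of_not_mem (hd a ha) (hz y hy).1),
        fun e => absurd e (ne_of_mem_of_not_mem (hr a ha) (hz' y hy).2.1)⟩
    · exact ⟨fun e => absurd e.symm (ne_of_mem_of_not_mem (hd b hb) (hz x hx).1),
        fun e => absurd e.symm (ne_of_mem_of_not_mem (hr b hb) (hz' x hx).2.1)⟩
    · exact hinj x hx y hy
  · intro a ha b hb
    simp only [Finset.mem_union, Finset.mem_image] at ha hb
    rcases ha with ha | ⟨x, hx, rfl⟩ <;> rcases hb with hb | ⟨y, hy, rfl⟩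
    · exact hp.adj a ha b hb
    · exact ⟨fun h => absurd h.symm ((hz y hy).2.2 _ (hd a ha)),
        fun h => absurd h.symm ((hz' y hy).2.2 _ (hr a ha))⟩
    · exact ⟨fun h => absurd h ((hz x hx).2.2 _ (hd b hb)),
        fun h => absurd h ((hz' x hx).2.2 _ (hr b hb))⟩
    · exact hadj x hx y hy
  · intro a ha
    simp only [Finset.mem_union] at ha
    have hnot : ∀ v, v ∈ relDom p ∨ v ∈ relRan p → v ∉ t.image z ∧ v ∉ t.image z' := by
      intro v hv
      simp only [Finset.mem_image, not_exists, not_and]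
      constructor
      · rintro x hx rfl
        exact hv.elim (hz x hx).1 (hz x hx).2.1
      · rintro x hx rfl
        exact hv.elim (hz' x hx).1 (hz' x hx).2.1
    rcases ha with ha | ha
    · have h1 := hnot _ (Or.inl (hd a ha))
      have h2 := hnot _ (Or.inr (hr a ha))
      simp only [h1.1, h1.2, h2.1, h2.2, if_false]
      exact hp.rank a ha
    · obtain ⟨x, hx, rfl⟩ := Finset.mem_image.1 ha
      have h1 : z' x ∉ t.image z := by
        simp only [Finset.mem_image, not_exists, not_and]
        exact fun y hy => hne y hy x hx
      simp only [h1, Finset.mem_image_of_mem z hx, Finset.mem_image_of_mem z' hx, if_true, if_false]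
      norm_num

/-- Neutralise `t` for the partial map and h(t) for its inverse. The two tuples are isomorphic via
`h`, so `g` may be made to carry one to the other; the word is v'⁻¹ g v. -/
theorem universalCliqueFree_dense_step (hn : 3 ≤ n) (hH : IsUniversalCliqueFree n H)
    (hf : (autSupport f).Infinite) (h : H ≃g H) (t : Finset V)
    (hp₀ : IsRankedPartialIso H p₀ ρ₀) :
    ∃ g ∈ noFiniteOrbits H, (∀ a ∈ p₀, g a.1 = a.2) ∧
      ∃ w ∈ Subgroup.closure {f, g}, ∀ x ∈ t, w x = h x := by
  set u := t.image h
  set O₁ := relDom p₀ ∪ relRan p₀ ∪ t ∪ u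
  obtain ⟨p₁, ρ₁, z, hp₁, hle₁, hcon₁, -, -, hz⟩ := hp₀.exists_neutral hn hH hf (t := t) (O := O₁)
    (fun v hv => by simp [O₁, hv]) (fun v hv => by simp [O₁, hv]) (fun v hv => by simp [O₁, hv])
  set O₂ := O₁ ∪ relDom p₁ ∪ relRan p₁ ∪ t.image z
  have huO₁ : u ⊆ O₁ := fun v hv => by simp [O₁, hv]
  obtain ⟨q, ρ₂, y, hq, hle₂, hcon₂, hran₂, hdom₂, hy⟩ := hp₁.swap.exists_neutral hn hH hf (t := u)
    (O := O₂) (fun v hv => by simp [O₂, huO₁ hv])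
    (fun v hv => by rw [relDom_image_swap] at hv; simp [O₂, hv])
    (fun v hv => by rw [relRan_image_swap] at hv; simp [O₂, hv])
  rw [relRan_image_swap, relDom_image_swap] at hdom₂
  rw [relRan_image_swap] at hran₂
  set p₂ := q.image Prod.swap
  have hp₂ := hq.swap
  have hle₁₂ : p₁ ⊆ p₂ := fun a ha => mem_image_swap.2 (hle₂ (mem_image_swap.2 ha))
  have hp₂d : relDom p₂ = relRan q := relDom_image_swap q
  have hp₂r : relRan p₂ = relDom q := relRan_image_swap q
  have hzO₂ : ∀ x ∈ t, z x ∈ O₂ := fun x hx =>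
    Finset.mem_union_right _ (Finset.mem_image_of_mem _ hx)
  have hyu : ∀ x ∈ t, h x ∈ u := fun x hx => Finset.mem_image_of_mem _ hx
  have hcon₂' : ∀ g : H ≃g H, (∀ a ∈ p₂, g a.1 = a.2) →
      ∃ w ∈ Subgroup.closure {f, g}, ∀ x ∈ u, w x = y x := by
    intro g hg
    obtain ⟨w, hw, hwu⟩ := hcon₂ g⁻¹ fun a ha => by
      have := hg (a.2, a.1) (mem_image_swap.2 ha)
      simp only at this
      rw [← this, RelIso.inv_apply_self]
    refine ⟨w, (Subgroup.closure_le _).2 ?_ hw, hwu⟩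
    rintro v (rfl | rfl)
    · exact Subgroup.subset_closure (by simp)
    · exact inv_mem (Subgroup.subset_closure (by simp))
  -- The auxiliary `g₀` only shows that `z` and `y` are restrictions of automorphisms, hence
  -- preserve equality and adjacency.
  obtain ⟨g₀, -, hg₀⟩ := hp₂.exists_extension hn hH hf
  obtain ⟨w, -, hw⟩ := hcon₁.mono hle₁₂ g₀ hg₀
  obtain ⟨w', -, hw'⟩ := hcon₂' g₀ hg₀
  obtain ⟨σ, hσ⟩ := hp₂.union_image (t := t) (z := z) (z' := fun x => y (h x))
    (fun a ha b hb => by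
      rw [← hw a ha, ← hw b hb, ← hw' _ (hyu a ha), ← hw' _ (hyu b hb), w.injective.eq_iff,
        w'.injective.eq_iff, h.injective.eq_iff])
    (fun a ha b hb => by
      rw [← hw a ha, ← hw b hb, ← hw' _ (hyu a ha), ← hw' _ (hyu b hb), w.map_adj_iff,
        w'.map_adj_iff, h.map_adj_iff])
    (fun a ha b hb e => (hy _ (hyu b hb)).1 (e ▸ hzO₂ a ha))
    (fun a ha => by
      obtain ⟨h1, h2, h3, h4, h5⟩ := hz a ha
      rw [hp₂d, hp₂r]
      refine ⟨fun h' => ?_, fun h' => ?_, fun c hc hadj => ?_⟩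
      · rcases hran₂ _ h' with h'' | h''
        · exact h2 h''
        · exact h''.1 (hzO₂ a ha)
      · rcases hdom₂ _ h' with h'' | h'' | h'' | h''
        · exact h3 h''
        · exact h1 (huO₁ h'')
        · exact h2 h''
        · exact h''.1 (hzO₂ a ha)
      · rcases hran₂ _ hc with h'' | h''
        · exact h5 c h'' hadj
        · exact h2 (h''.2 _ (hzO₂ a ha) hadj.symm))
    (fun a ha => by
      obtain ⟨h1, h2, h3, h4, h5⟩ := hy _ (hyu a ha)
      rw [hp₂d, hp₂r]
      exact ⟨h3, h2, h5⟩)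
  obtain ⟨g, hg, hgσ⟩ := hσ.exists_extension hn hH hf
  have hgp₂ : ∀ a ∈ p₂, g a.1 = a.2 := fun a ha => hgσ a (Finset.mem_union_left _ ha)
  obtain ⟨v, hv, hvt⟩ := hcon₁.mono hle₁₂ g hgp₂
  obtain ⟨v', hv', hvu⟩ := hcon₂' g hgp₂
  refine ⟨g, hg, fun a ha => hgp₂ a (hle₁₂ (hle₁ ha)), v'⁻¹ * g * v,
    mul_mem (mul_mem (inv_mem hv') (Subgroup.subset_closure (by simp))) hv, fun x hx => ?_⟩
  have := hgσ (z x, y (h x)) (Finset.mem_union_right _ (Finset.mem_image.2 ⟨x, hx, rfl⟩))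
  simp only at this
  rw [RelIso.mul_apply, RelIso.mul_apply, hvt x hx, this, ← hvu _ (hyu x hx),
    RelIso.inv_apply_self]

end Neutral

theorem universalCliqueFree_comeagreIn {V : Type*} {H : SimpleGraph V} {n : ℕ} (hn : 3 ≤ n)
    (hH : IsUniversalCliqueFree n H) {f : H ≃g H} (hf : (autSupport f).Infinite) :
    ComeagreIn (denseMates f ∩ noFiniteOrbits H) (noFiniteOrbits H) := by
  classical
  have := hH.countable
  refine comeagreIn_denseMates_of_forall f _ fun h t g hg s => ?_
  obtain ⟨ρ, hρ⟩ := exists_isRankedPartialIso hg s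
  obtain ⟨g', hg', hs, hw⟩ := universalCliqueFree_dense_step hn hH hf h t hρ
  exact ⟨g', hg', fun x hx => hs (x, g x) (Finset.mem_image.2 ⟨x, hx, rfl⟩), hw⟩

theorem theorem1p2 :
    (∀ n : ℕ, 3 ≤ n → ∀ (V : Type*) (H : SimpleGraph V), IsUniversalCliqueFree n H →
      ∀ f : H ≃g H, (autSupport f).Infinite →
        ComeagreIn (denseMates f ∩ noFiniteOrbits H) (noFiniteOrbits H)) ∧
    (∀ n : ℕ, 1 ≤ n → ∀ f : omegaK n ≃g omegaK n,
      {c | componentPerm f c ≠ c}.Infinite →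
      ∀ S : Finset (ℕ × Fin n),
        ComeagreIn (denseMates f ∩ noFiniteOrbitsReps (omegaK n) (S : Set (ℕ × Fin n)))
          (noFiniteOrbitsReps (omegaK n) (S : Set (ℕ × Fin n)))) ∧
    (∀ n : ℕ, 2 ≤ n → ∀ f : copiesKomega n ≃g copiesKomega n,
      (∀ Γ : Set (Fin n × ℕ), Γ.Finite → Γ.Nonempty → f '' Γ = Γ →
        ∃ L L' : (copiesKomega n).ConnectedComponent,
          (L.supp ∩ Γ).ncard ≠ (L'.supp ∩ Γ).ncard) →
      ∀ S : Finset (Fin n × ℕ),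
        ComeagreIn (denseMates f ∩ componentMatesReps f (S : Set (Fin n × ℕ)))
          (componentMatesReps f (S : Set (Fin n × ℕ)))) := by
  exact ⟨fun n hn V H hH f hf => universalCliqueFree_comeagreIn hn hH hf,
    fun n hn f hf S => omegaK_comeagreIn hn f hf S,
    fun n hn f hf S => copiesKomega_comeagreIn (by omega) f hf S⟩
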